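/- Let $G$ be a finite simple graph with $n$ vertices. Suppose that $G$ is outerplanar, that is, $G$ can be drawn in the plane without crossings (vertices as distinct points, edges as arcs joining their ends, where an arc passes through no vertex other than its ends and two distinct arcs meet only in common ends) in such a way that every vertex lies on the boundary of the outer (unbounded) face. Then $\mathrm{ssp}(G) \le n$. Here $\mathrm{ssp}(G)$ denotes the minimum size of a strongly separating path system of $G$, that is, of a collection $\mathcal{P}$ of paths in $G$ such that for every two distinct edges $e, f$ of $G$ there are a path in $\mathcal{P}$ that contains $e$ but not $f$ and a path in $\mathcal{P}$ that contains $f$ but not $e$. -/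

import Mathlib

/-- The Euclidean plane. -/
abbrev Plane : Type := EuclideanSpace ℝ (Fin 2)

/-- `A` is an arc in the plane with endpoints `x` and `y`: the image of an injective continuous
map from the unit interval that sends `0` to `x` and `1` to `y`. -/
def IsArcBetween (A : Set Plane) (x y : Plane) : Prop :=
  ∃ γ : Path x y, Function.Injective γ ∧ Set.range γ = A

/-- A drawing of `G` in the plane without crossings: distinct vertices are distinct points, every
edge is an arc between its two ends, an arc passes through no vertex other than its ends, and two
distinct arcs meet only in common ends. -/
structure PlaneDrawing {V : Type*} (G : SimpleGraph V) where
  /-- the point that represents a vertex -/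
  point : V → Plane
  /-- the arc that represents an edge -/
  arc : G.edgeSet → Set Plane
  point_injective : Function.Injective point
  isArcBetween : ∀ (u v : V) (h : G.Adj u v),
    IsArcBetween (arc ⟨s(u, v), h⟩) (point u) (point v)
  point_mem_arc : ∀ (w : V) (e : G.edgeSet), point w ∈ arc e → w ∈ (e : Sym2 V)
  arc_inter_arc : ∀ e f : G.edgeSet, e ≠ f →
    arc e ∩ arc f ⊆ point '' {w : V | w ∈ (e : Sym2 V) ∧ w ∈ (f : Sym2 V)}

/-- The set of points of the plane that are covered by the drawing. -/
def PlaneDrawing.carrier {V : Type*} {G : SimpleGraph V} (D : PlaneDrawing G) : Set Plane :=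
  Set.range D.point ∪ ⋃ e : G.edgeSet, D.arc e

/-- The outer face: the unbounded connected component of the complement of the drawing. (For a
finite graph the drawing is compact, so there is exactly one such component.) -/
def PlaneDrawing.outerFace {V : Type*} {G : SimpleGraph V} (D : PlaneDrawing G) : Set Plane :=
  {z : Plane | z ∈ D.carrierᶜ ∧ ¬ Bornology.IsBounded (connectedComponentIn D.carrierᶜ z)}

/-- A graph is outerplanar if it has a drawing in the plane without crossings in which every
vertex lies on the boundary of the outer face. -/
def IsOuterplanar {V : Type*} (G : SimpleGraph V) : Prop :=
  ∃ D : PlaneDrawing G, ∀ v : V, D.point v ∈ frontier D.outerFace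

/-- A path of `G`, together with its two ends. -/
abbrev GraphPath {V : Type*} (G : SimpleGraph V) : Type _ :=
  Σ u v : V, G.Path u v

/-- The path `P` contains the edge `e`. -/
def GraphPath.Contains {V : Type*} {G : SimpleGraph V} (P : GraphPath G) (e : Sym2 V) : Prop :=
  e ∈ P.2.2.val.edges

/-- The edges `e` and `f` are separated by the collection `S` of paths: some path of `S` contains
`e` but avoids `f`, and some path of `S` contains `f` but avoids `e`. -/
def IsSeparatedBy {V : Type*} {G : SimpleGraph V} (S : Set (GraphPath G)) (e f : Sym2 V) : Prop :=
  (∃ P ∈ S, GraphPath.Contains P e ∧ ¬ GraphPath.Contains P f) ∧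
    (∃ P ∈ S, GraphPath.Contains P f ∧ ¬ GraphPath.Contains P e)

/-- A collection of paths of `G` that separates every pair of distinct edges of `G`. -/
def IsStronglySeparatingPathSystem {V : Type*} (G : SimpleGraph V)
    (S : Set (GraphPath G)) : Prop :=
  ∀ e ∈ G.edgeSet, ∀ f ∈ G.edgeSet, e ≠ f → IsSeparatedBy S e f

/-- The strong separation number of `G`: the minimum size of a strongly separating path system of
`G`. It takes values in `ℕ∞`, so that the infimum has no default value to fall back on. -/
noncomputable def ssp {V : Type*} (G : SimpleGraph V) : ℕ∞ :=
  ⨅ (S : Set (GraphPath G)) (_ : IsStronglySeparatingPathSystem G S), S.encard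

/-! Two facts give the bound: an outerplanar graph is 2-degenerate, that is, every nonempty vertex
set contains a vertex with at most two neighbours in it; and a 2-degenerate graph on n vertices has
a strongly separating system of at most n paths.

The second fact (`exists_isPathFamily`) is an induction that adds a vertex v of degree at most two.
The invariant is that every edge lies in two paths and every vertex is the end of two paths. For
each neighbour of v, a path ending there is extended to v, a different path for each; one new path
consists of the edges at v.

For the first fact, suppose that all degrees inside a set are at least three. A longest path, chosen
with care, gives four vertices joined pairwise by walks, where walks without a common end are
disjoint (`exists_walks_of_three_neighbors`). In an outerplanar drawing a point of the outer face
can be joined to these four vertices away from the walks that do not end there. This yields a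
drawing of the complete graph on five vertices in which independent edges do not meet.

Such a drawing is impossible (`exists_inter_nonempty_of_five`), by a parity argument. Edges are
approximated by polygonal lines in general position. Straightening an edge changes the crossing
numbers modulo 2 by terms that cancel in the sum over all independent pairs, and a straight-line
drawing has an odd number of crossings. That last claim is a finite check on orientation signs. -/

/-! ### Orientation signs of points in the plane -/

/-- Twice the signed area of the triangle `a b c`. -/
def orient (a b c : Plane) : ℝ :=
  (b 0 - a 0) * (c 1 - a 1) - (b 1 - a 1) * (c 0 - a 0)

open Classical in
/-- Whether the triangle `a b c` is positively oriented. -/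
noncomputable def orientSign (a b c : Plane) : Bool := decide (0 < orient a b c)

/-- The integer modulo `2` that represents a truth value. -/
def parity (x : Bool) : ZMod 2 := bif x then 1 else 0

lemma parity_add (x y : Bool) : parity x + parity y = parity (x ^^ y) := by
  revert x y; decide

/-- Whether the segments `a b` and `c d` cross, in terms of orientations. -/
noncomputable def segCross (a b c d : Plane) : ZMod 2 :=
  parity ((orientSign a b c ^^ orientSign a b d) && (orientSign c d a ^^ orientSign c d b))

/-- Whether the point `u` lies in the triangle `a b c`, in terms of orientations. -/
noncomputable def inTriangle (a b c u : Plane) : ZMod 2 :=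
  parity (orientSign a b u == orientSign b c u && orientSign b c u == orientSign c a u)

lemma segCross_comm (a b c d : Plane) : segCross a b c d = segCross c d a b := by
  unfold segCross; rw [Bool.and_comm]

lemma orient_rotate (a b c : Plane) : orient b c a = orient a b c := by
  unfold orient; ring

lemma orient_swap (a b c : Plane) : orient b a c = -orient a b c := by
  unfold orient; ring

lemma orient_orders {a b c : Plane} (h : orient a b c ≠ 0) :
    orient b c a ≠ 0 ∧ orient c a b ≠ 0 ∧ orient b a c ≠ 0 ∧ orient a c b ≠ 0 ∧
      orient c b a ≠ 0 := by
  have swap : orient b a c ≠ 0 := by rw [orient_swap]; simpa using h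
  exact ⟨by rwa [orient_rotate], by rwa [orient_rotate, orient_rotate], swap,
    by rwa [orient_rotate], by rwa [orient_rotate, orient_rotate]⟩

/-- Rotations preserve the sign always; a transposition negates it only off zero, since `orientSign`
is `false` on collinear triples. -/
lemma orientSign_orders {a b c : Plane} (h : orient a b c ≠ 0) :
    orientSign b c a = orientSign a b c ∧ orientSign c a b = orientSign a b c ∧
    orientSign b a c = (!orientSign a b c) ∧ orientSign a c b = (!orientSign a b c) ∧
    orientSign c b a = (!orientSign a b c) := by
  have rot (x y z : Plane) : orientSign y z x = orientSign x y z := by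
    rw [orientSign, orient_rotate, orientSign]
  have swap : orientSign b a c = !orientSign a b c := by
    unfold orientSign
    rw [orient_swap a b c]
    rcases lt_or_gt_of_ne h with h | h <;> simp [h, not_lt.mpr h.le]
  exact ⟨rot a b c, (rot c a b).symm, swap, (rot b a c).trans swap, (rot c b a).symm.trans swap⟩

/-- Four truth values are not all equal. -/
def notAllEq (x y z w : Bool) : Bool := !(x == y && y == z && z == w)

/-- The signed areas of bcd, -acd, abd and -abc sum to zero, so they cannot all have the same sign.
-/
lemma orientSign_four {a b c d : Plane} (h1 : orient a b c ≠ 0) (h2 : orient a b d ≠ 0)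
    (h3 : orient a c d ≠ 0) (h4 : orient b c d ≠ 0) :
    notAllEq (orientSign b c d) (!orientSign a c d) (orientSign a b d) (!orientSign a b c) = true
      := by
  have key : orient b c d - orient a c d + orient a b d - orient a b c = 0 := by
    unfold orient; ring
  unfold orientSign
  rcases lt_or_gt_of_ne h1 with h1 | h1 <;> rcases lt_or_gt_of_ne h2 with h2 | h2 <;>
  rcases lt_or_gt_of_ne h3 with h3 | h3 <;> rcases lt_or_gt_of_ne h4 with h4 | h4 <;>
  first
    | (exfalso; linarith)
    | simp [h1, not_lt.mpr h1.le, h2, not_lt.mpr h2.le, h3, not_lt.mpr h3.le,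
        h4, not_lt.mpr h4.le, notAllEq]

lemma decide_mul_pos {x y : ℝ} (hx : x ≠ 0) (hy : y ≠ 0) :
    decide (0 < x * y) = !(decide (0 < x) ^^ decide (0 < y)) := by
  rcases lt_or_gt_of_ne hx with hx | hx <;> rcases lt_or_gt_of_ne hy with hy | hy
  · simp [not_lt.mpr hx.le, not_lt.mpr hy.le, mul_pos_of_neg_of_neg hx hy]
  · simp [hy]
  · simp [hx]
  · simp [hx, hy, mul_pos hx hy]

/-- The sign form of the three-term Grassmann–Plücker relation. -/
lemma orientSign_plucker {a b c d e : Plane} (h1 : orient a b c ≠ 0) (h2 : orient a d e ≠ 0)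
    (h3 : orient a b d ≠ 0) (h4 : orient a c e ≠ 0) (h5 : orient a b e ≠ 0)
    (h6 : orient a c d ≠ 0) :
    notAllEq (orientSign a b c ^^ orientSign a d e) (!(orientSign a b d ^^ orientSign a c e))
      (orientSign a b e ^^ orientSign a c d) (orientSign a b e ^^ orientSign a c d) = true := by
  -- With x, y, z for the three products, x - y + z = 0, so x, -y, z do not all have one sign. The
  -- statement repeats its last entry because `notAllEq` takes four arguments.
  have key : orient a b c * orient a d e - orient a b d * orient a c e
      + orient a b e * orient a c d = 0 := by unfold orient; ring
  have e1 := decide_mul_pos h1 h2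
  have e2 := decide_mul_pos h3 h4
  have e3 := decide_mul_pos h5 h6
  have n1 := mul_ne_zero h1 h2
  have n2 := mul_ne_zero h3 h4
  have n3 := mul_ne_zero h5 h6
  generalize orient a b c * orient a d e = x at *
  generalize orient a b d * orient a c e = y at *
  generalize orient a b e * orient a c d = z at *
  have f1 : (orientSign a b c ^^ orientSign a d e) = !decide (0 < x) := by
    rw [e1, Bool.not_not]; simp [orientSign]
  have f2 : (orientSign a b d ^^ orientSign a c e) = !decide (0 < y) := by
    rw [e2, Bool.not_not]; simp [orientSign]
  have f3 : (orientSign a b e ^^ orientSign a c d) = !decide (0 < z) := by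
    rw [e3, Bool.not_not]; simp [orientSign]
  rw [f1, f2, f3]
  rcases lt_or_gt_of_ne n1 with n1 | n1 <;> rcases lt_or_gt_of_ne n2 with n2 | n2 <;>
  rcases lt_or_gt_of_ne n3 with n3 | n3 <;>
  first
    | (exfalso; linarith)
    | simp [n1, not_lt.mpr n1.le, n2, not_lt.mpr n2.le, n3, not_lt.mpr n3.le,
        notAllEq]

/-- The sign relations satisfied by the orientations of five points in general position. -/
def signRelations (abc abd abe acd ace ade bcd bce bde cde : Bool) : Bool :=
  notAllEq bcd (!acd) abd (!abc) &&
    notAllEq bce (!ace) abe (!abc) &&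
    notAllEq bde (!ade) abe (!abd) &&
    notAllEq cde (!ade) ace (!acd) &&
    notAllEq cde (!bde) bce (!bcd) &&
    notAllEq (abc ^^ ade) (!(abd ^^ ace)) (abe ^^ acd) (abe ^^ acd) &&
    notAllEq ((!abc) ^^ bde) (!((!abd) ^^ bce)) ((!abe) ^^ bcd) ((!abe) ^^ bcd) &&
    notAllEq (abc ^^ cde) (!((!acd) ^^ (!bce))) ((!ace) ^^ (!bcd)) ((!ace) ^^ (!bcd)) &&
    notAllEq (abd ^^ (!cde)) (!(acd ^^ (!bde))) ((!ade) ^^ bcd) ((!ade) ^^ bcd) &&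
    notAllEq (abe ^^ cde) (!(ace ^^ bde)) (ade ^^ bce) (ade ^^ bce)

/-- The three sides of the triangle `a b c` cross `d e` as often, modulo `2`, as `d` and `e` lie in
the triangle. -/
def triangleParity (abd abe acd ace ade bcd bce bde cde : Bool) : Bool :=
  ((abd ^^ abe) && (ade ^^ bde)) ^^ ((bcd ^^ bce) && (bde ^^ cde)) ^^
  ((acd ^^ ace) && (ade ^^ cde)) ^^
  (abd == bcd && bcd == !acd) ^^ (abe == bce && bce == !ace)

/-- The number of crossings, modulo `2`, of the straight-line drawing of the complete graph on five
points. -/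
def crossingParity (abc abd abe acd ace ade bcd bce bde cde : Bool) : Bool :=
  ((abc ^^ abd) && (acd ^^ bcd)) ^^
  ((abc ^^ abe) && (ace ^^ bce)) ^^
  ((abd ^^ abe) && (ade ^^ bde)) ^^
  (((!abc) ^^ acd) && (abd ^^ (!bcd))) ^^
  (((!abc) ^^ ace) && (abe ^^ (!bce))) ^^
  ((acd ^^ ace) && (ade ^^ cde)) ^^
  (((!abd) ^^ (!acd)) && (abc ^^ bcd)) ^^
  (((!abd) ^^ ade) && (abe ^^ (!bde))) ^^
  (((!acd) ^^ ade) && (ace ^^ (!cde))) ^^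
  (((!abe) ^^ (!ace)) && (abc ^^ bce)) ^^
  (((!abe) ^^ (!ade)) && (abd ^^ bde)) ^^
  (((!ace) ^^ (!ade)) && (acd ^^ cde)) ^^
  ((bcd ^^ bce) && (bde ^^ cde)) ^^
  (((!bcd) ^^ bde) && (bce ^^ (!cde))) ^^
  (((!bce) ^^ (!bde)) && (bcd ^^ cde))

/-- The geometry enters only through `signRelations`: every one of the 1024 sign vectors that
satisfies them satisfies the parity claim. -/
lemma triangleParity_eq : ∀ abc abd abe acd ace ade bcd bce bde cde : Bool,
    (!signRelations abc abd abe acd ace ade bcd bce bde cde ||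
      !triangleParity abd abe acd ace ade bcd bce bde cde) = true := by
  decide +kernel

lemma crossingParity_eq : ∀ abc abd abe acd ace ade bcd bce bde cde : Bool,
    (!signRelations abc abd abe acd ace ade bcd bce bde cde ||
      crossingParity abc abd abe acd ace ade bcd bce bde cde) = true := by
  decide +kernel

/-- Five points of the plane are in general position. -/
structure GeneralPosition (a b c d e : Plane) : Prop where
  abc : orient a b c ≠ 0
  abd : orient a b d ≠ 0
  abe : orient a b e ≠ 0
  acd : orient a c d ≠ 0
  ace : orient a c e ≠ 0
  ade : orient a d e ≠ 0
  bcd : orient b c d ≠ 0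
  bce : orient b c e ≠ 0
  bde : orient b d e ≠ 0
  cde : orient c d e ≠ 0

/-- There is one four-term area relation for each omitted point and one Grassmann–Plücker relation
for each base point, all rewritten to alphabetical order. -/
lemma GeneralPosition.signRelations {a b c d e : Plane} (h : GeneralPosition a b c d e) :
    signRelations (orientSign a b c) (orientSign a b d) (orientSign a b e) (orientSign a c d)
      (orientSign a c e) (orientSign a d e) (orientSign b c d)
      (orientSign b c e) (orientSign b d e) (orientSign c d e) = true := by
  have a1 := orientSign_plucker h.abc h.ade h.abd
    h.ace h.abe h.acd
  have b1 := orientSign_plucker (orient_orders h.abc).2.2.1 h.bde (orient_orders h.abd).2.2.1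
    h.bce (orient_orders h.abe).2.2.1 h.bcd
  have c1 := orientSign_plucker (orient_orders h.abc).2.1 h.cde (orient_orders h.acd).2.2.1
    (orient_orders h.bce).2.2.1 (orient_orders h.ace).2.2.1 (orient_orders h.bcd).2.2.1
  have d1 := orientSign_plucker (orient_orders h.abd).2.1 (orient_orders h.cde).2.2.1
    (orient_orders h.acd).2.1
    (orient_orders h.bde).2.2.1 (orient_orders h.ade).2.2.1 (orient_orders h.bcd).2.1
  have e1 := orientSign_plucker (orient_orders h.abe).2.1 (orient_orders h.cde).2.1
    (orient_orders h.ace).2.1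
    (orient_orders h.bde).2.1 (orient_orders h.ade).2.1 (orient_orders h.bce).2.1
  simp only [orientSign_orders h.abc, orientSign_orders h.abd, orientSign_orders h.abe,
    orientSign_orders h.acd,
    orientSign_orders h.ace, orientSign_orders h.ade,
    orientSign_orders h.bcd,
    orientSign_orders h.bce,
    orientSign_orders h.bde, orientSign_orders h.cde] at a1 b1 c1 d1 e1
  simp only [_root_.signRelations, Bool.and_eq_true, and_assoc]
  exact ⟨orientSign_four h.abc h.abd h.acd h.bcd, orientSign_four h.abc h.abe h.ace h.bce,
    orientSign_four h.abd h.abe h.ade h.bde, orientSign_four h.acd h.ace h.ade h.cde,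
    orientSign_four h.bcd h.bce h.bde h.cde, a1, b1, c1, d1, e1⟩

/-- The sides of a triangle cross a segment as often, modulo `2`, as ends of the segment lie in the
triangle. -/
lemma GeneralPosition.triangle {a b c d e : Plane} (h : GeneralPosition a b c d e) :
    segCross a b d e + segCross b c d e + segCross a c d e =
      inTriangle a b c d + inTriangle a b c e := by
  have H := triangleParity_eq (orientSign a b c) (orientSign a b d) (orientSign a b e)
    (orientSign a c d)
      (orientSign a c e) (orientSign a d e) (orientSign b c d)
      (orientSign b c e) (orientSign b d e) (orientSign c d e)
  rw [h.signRelations, Bool.not_true, Bool.false_or, Bool.not_eq_true'] at H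
  have parity_eq : ∀ x y z u v : Bool, (x ^^ y ^^ z ^^ u ^^ v) = false →
      parity x + parity y + parity z = parity u + parity v := by decide
  apply parity_eq
  simp only [orientSign_orders h.acd, orientSign_orders h.ace, orientSign_orders h.ade,
    orientSign_orders h.bde, orientSign_orders h.cde]
  simpa only [triangleParity, Bool.xor_not, Bool.not_xor, Bool.not_not] using H

/-- A straight-line drawing of the complete graph on five points has an odd number of crossings. -/
lemma GeneralPosition.sum_segCross {a b c d e : Plane} (h : GeneralPosition a b c d e) :
    segCross a b c d + segCross a b c e + segCross a b d e + segCross a c b d +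
    segCross a c b e + segCross a c d e + segCross a d b c + segCross a d b e +
    segCross a d c e + segCross a e b c + segCross a e b d + segCross a e c d +
    segCross b c d e + segCross b d c e + segCross b e c d = 1 := by
  have H := crossingParity_eq (orientSign a b c) (orientSign a b d) (orientSign a b e)
    (orientSign a c d)
      (orientSign a c e) (orientSign a d e) (orientSign b c d)
      (orientSign b c e) (orientSign b d e) (orientSign c d e)
  rw [h.signRelations, Bool.not_true, Bool.false_or] at H
  simp only [segCross, parity_add, orientSign_orders h.abc,
    orientSign_orders h.abd, orientSign_orders h.abe,
    orientSign_orders h.acd,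
    orientSign_orders h.ace, orientSign_orders h.ade,
    orientSign_orders h.bcd,
    orientSign_orders h.bce,
    orientSign_orders h.bde, orientSign_orders h.cde]
  rw [show (1 : ZMod 2) = parity true from rfl, ← H]
  rfl

open Finset

/-! ### Crossings of polygonal lines modulo 2 -/

/-- A family of points of which no three are collinear. -/
def InGeneralPosition {ι : Type*} (q : ι → Plane) : Prop :=
  ∀ i j k, i ≠ j → i ≠ k → j ≠ k → orient (q i) (q j) (q k) ≠ 0

lemma InGeneralPosition.five {ι : Type*} {q : ι → Plane} (hq : InGeneralPosition q)
    {a b c d e : ι} (h : [a, b, c, d, e].Nodup) :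
    GeneralPosition (q a) (q b) (q c) (q d) (q e) := by
  simp only [List.nodup_cons, List.mem_cons, List.not_mem_nil, or_false, not_or] at h
  obtain ⟨⟨h1, h2, h3, h4⟩, ⟨h5, h6, h7⟩, ⟨h8, h9⟩, h10, -⟩ := h
  constructor <;> apply hq <;> assumption

/-- The number, modulo `2`, of crossings of two polygonal lines. -/
noncomputable def polyCross (c : ℕ → Plane) (n : ℕ) (d : ℕ → Plane) (m : ℕ) : ZMod 2 :=
  ∑ a ∈ range n, ∑ b ∈ range m, segCross (c a) (c (a + 1)) (d b) (d (b + 1))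

lemma polyCross_comm (c : ℕ → Plane) (n : ℕ) (d : ℕ → Plane) (m : ℕ) :
    polyCross c n d m = polyCross d m c n := by
  unfold polyCross
  rw [sum_comm]
  simp only [segCross_comm]

/-- Straightening a polygonal line changes its number of crossings with another one by an amount
that depends only on the ends of the latter. -/
lemma polyCross_straighten {ι : Type*} {q : ι → Plane} (hq : InGeneralPosition q)
    {c : ℕ → ι} {n : ℕ} (hn : 1 ≤ n) (hc : Set.InjOn c (Set.Iic n)) :
    ∃ φ : ι → ZMod 2, ∀ (d : ℕ → ι) (m : ℕ), (∀ b < m, d b ≠ d (b + 1)) →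
      (∀ a ≤ n, ∀ b ≤ m, c a ≠ d b) →
      polyCross (q ∘ c) n (q ∘ d) m =
        (∑ b ∈ range m, segCross (q (c 0)) (q (c n)) (q (d b)) (q (d (b + 1)))) +
          φ (d 0) + φ (d m) := by
  induction n, hn using Nat.le_induction with
  | base => exact ⟨0, fun d m _ _ => by simp [polyCross]⟩
  | succ n hn ih =>
    obtain ⟨φ, hφ⟩ := ih (hc.mono (Set.Iic_subset_Iic.2 n.le_succ))
    -- Cutting off the corner at `c n` changes the count by the indicator of the triangle with
    -- vertices `c 0`, `c n`, `c (n + 1)`, evaluated at the two ends of `d`.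
    refine ⟨fun u => φ u + inTriangle (q (c 0)) (q (c n)) (q (c (n + 1))) (q u),
      fun d m hd hcd => ?_⟩
    have h1 := hφ d m hd (fun a ha => hcd a (ha.trans n.le_succ))
    have ne {a b : ℕ} (ha : a ≤ n + 1) (hb : b ≤ n + 1) (hab : a ≠ b) : c a ≠ c b :=
      fun h => hab (hc ha hb h)
    -- The triangle relation for one segment of `d`. The sum of the two indicators is written as a
    -- difference, which is the same modulo 2, so that it telescopes along `d`.
    have tri : ∀ b ∈ range m,
        segCross (q (c n)) (q (c (n + 1))) (q (d b)) (q (d (b + 1))) =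
        segCross (q (c 0)) (q (c (n + 1))) (q (d b)) (q (d (b + 1))) +
        segCross (q (c 0)) (q (c n)) (q (d b)) (q (d (b + 1))) +
        (inTriangle (q (c 0)) (q (c n)) (q (c (n + 1))) (q (d (b + 1))) -
          inTriangle (q (c 0)) (q (c n)) (q (c (n + 1))) (q (d b))) := by
      intro b hb
      rw [mem_range] at hb
      have := (hq.five (a := c 0) (b := c n) (c := c (n + 1)) (d := d b) (e := d (b + 1)) (by
        simp [ne (a := 0) (b := n) (by lia) (by lia) (by lia),
          ne (a := 0) (b := n + 1) (by lia) (by lia) (by lia),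
          ne (a := n) (b := n + 1) (by lia) (by lia) (by lia), hd b hb,
          hcd 0 (by lia) b hb.le, hcd 0 (by lia) (b + 1) hb, hcd n (by lia) b hb.le,
          hcd n (by lia) (b + 1) hb, hcd (n + 1) le_rfl b hb.le,
          hcd (n + 1) le_rfl (b + 1) hb])).triangle
      generalize segCross (q (c n)) (q (c (n + 1))) (q (d b)) (q (d (b + 1))) = x1 at *
      generalize segCross (q (c 0)) (q (c (n + 1))) (q (d b)) (q (d (b + 1))) = x2 at *
      generalize segCross (q (c 0)) (q (c n)) (q (d b)) (q (d (b + 1))) = x3 at *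
      generalize inTriangle (q (c 0)) (q (c n)) (q (c (n + 1))) (q (d b)) = x4 at *
      generalize inTriangle (q (c 0)) (q (c n)) (q (c (n + 1))) (q (d (b + 1))) = x5 at *
      clear * - this
      revert this x1 x2 x3 x4 x5
      decide
    have hstep : polyCross (q ∘ c) (n + 1) (q ∘ d) m = polyCross (q ∘ c) n (q ∘ d) m +
        ∑ b ∈ range m, segCross (q (c n)) (q (c (n + 1))) (q (d b)) (q (d (b + 1))) := by
      simp [polyCross, sum_range_succ]
    rw [hstep, h1, sum_congr rfl tri, sum_add_distrib, sum_add_distrib,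
      sum_range_sub (fun b => inTriangle (q (c 0)) (q (c n)) (q (c (n + 1))) (q (d b)))]
    generalize ∑ b ∈ range m, segCross (q (c 0)) (q (c n)) (q (d b)) (q (d (b + 1))) = x1
    generalize ∑ b ∈ range m, segCross (q (c 0)) (q (c (n + 1))) (q (d b)) (q (d (b + 1))) = x2
    have two : (2 : ZMod 2) = 0 := rfl
    linear_combination (x1 - inTriangle (q (c 0)) (q (c n)) (q (c (n + 1))) (q (d 0))) * two

/-- A polygonal line with distinct vertices, in terms of labels of points. -/
structure LabelLine (ι : Type*) where
  /-- the label of a vertex of the line -/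
  vertex : ℕ → ι
  /-- the number of segments -/
  length : ℕ
  length_pos : 1 ≤ length
  injOn : Set.InjOn vertex (Set.Iic length)

namespace LabelLine

variable {ι : Type*}

/-- The last vertex of a line. -/
def last (L : LabelLine ι) : ι := L.vertex L.length

/-- The first vertex of a line. -/
def first (L : LabelLine ι) : ι := L.vertex 0

/-- Two lines have no vertex in common. -/
def Disjoint (L M : LabelLine ι) : Prop :=
  ∀ a ≤ L.length, ∀ b ≤ M.length, L.vertex a ≠ M.vertex b

/-- The number, modulo `2`, of crossings of two lines. -/
noncomputable def cross (q : ι → Plane) (L M : LabelLine ι) : ZMod 2 :=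
  polyCross (q ∘ L.vertex) L.length (q ∘ M.vertex) M.length

lemma vertex_ne (L : LabelLine ι) {a b : ℕ} (ha : a ≤ L.length) (hb : b ≤ L.length)
    (h : a ≠ b) : L.vertex a ≠ L.vertex b := fun e => h (L.injOn ha hb e)

/-- The line with a single segment between the ends of a line. -/
def straight (L : LabelLine ι) : LabelLine ι where
  vertex := fun k => if k = 0 then L.first else L.last
  length := 1
  length_pos := le_rfl
  injOn := by
    have := L.vertex_ne (Nat.zero_le _) le_rfl (Nat.one_le_iff_ne_zero.1 L.length_pos).symm
    intro a ha b hb hab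
    rw [Set.mem_Iic] at ha hb
    interval_cases a <;> interval_cases b <;> simp_all [first, last]

/-- Straighten `L` against `M`, then `M` against the straightened `L`. Each correction depends on
one line and on the ends of the other. -/
lemma exists_cross_eq {q : ι → Plane} (hq : InGeneralPosition q) :
    ∃ φ : LabelLine ι → ι → ZMod 2, ∀ L M : LabelLine ι, L.Disjoint M →
      cross q L M = segCross (q L.first) (q L.last) (q M.first) (q M.last) +
        φ L M.first + φ L M.last + φ M L.first + φ M L.last := by
  choose φ hφ using fun L : LabelLine ι => polyCross_straighten hq L.length_pos L.injOn
  refine ⟨φ, fun L M h => ?_⟩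
  have h1 := hφ L M.vertex M.length
    (fun b hb => M.vertex_ne hb.le hb b.lt_succ_self.ne) h
  have h2 := hφ M L.straight.vertex L.straight.length
    (fun b hb => L.straight.vertex_ne hb.le hb b.lt_succ_self.ne) (by
      intro a ha b hb
      by_cases hb0 : b = 0
      · simpa [straight, hb0, first] using (h 0 (Nat.zero_le _) a ha).symm
      · simpa [straight, hb0, last] using (h _ le_rfl a ha).symm)
  rw [polyCross_comm] at h2
  have e1 : polyCross (q ∘ L.straight.vertex) L.straight.length (q ∘ M.vertex) M.length =
      ∑ b ∈ range M.length,
        segCross (q L.first) (q L.last) (q (M.vertex b)) (q (M.vertex (b + 1))) := by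
    simp [polyCross, straight]
  rw [e1] at h2
  unfold cross
  rw [h1]
  simp only [first, last] at *
  rw [h2]
  simp [straight, first, last, segCross_comm (q (M.vertex 0))]
  ring

/-- In a polygonal drawing of the complete graph on five vertices, two independent edges cross. -/
theorem exists_cross_ne_zero {q : ι → Plane} (hq : InGeneralPosition q) {p : Fin 5 → ι}
    (hp : Function.Injective p) {L : Fin 5 → Fin 5 → LabelLine ι}
    (hfirst : ∀ i j, i < j → (L i j).first = p i) (hlast : ∀ i j, i < j → (L i j).last = p j)
    (hdisj : ∀ i j k l, i < j → k < l → [i, j, k, l].Nodup → (L i j).Disjoint (L k l)) :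
    ∃ i j k l, i < j ∧ k < l ∧ [i, j, k, l].Nodup ∧ cross q (L i j) (L k l) ≠ 0 := by
  by_contra! H
  obtain ⟨φ, hφ⟩ := exists_cross_eq hq
  have key (i j k l : Fin 5) (h1 : i < j) (h2 : k < l) (h3 : [i, j, k, l].Nodup) :
      segCross (q (p i)) (q (p j)) (q (p k)) (q (p l)) +
        φ (L i j) (p k) + φ (L i j) (p l) + φ (L k l) (p i) + φ (L k l) (p j) = 0 := by
    rw [← H i j k l h1 h2 h3, hφ _ _ (hdisj i j k l h1 h2 h3), hfirst i j h1, hlast i j h1,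
      hfirst k l h2, hlast k l h2]
  have hsum := (hq.five (a := p 0) (b := p 1) (c := p 2) (d := p 3) (e := p 4) (by
    rw [show [p 0, p 1, p 2, p 3, p 4] = [0, 1, 2, 3, 4].map p from rfl]
    exact List.Nodup.map hp (by decide))).sum_segCross
  have two : (2 : ZMod 2) = 0 := rfl
  have k1 := key 0 1 2 3 (by decide) (by decide) (by decide)
  have k2 := key 0 1 2 4 (by decide) (by decide) (by decide)
  have k3 := key 0 1 3 4 (by decide) (by decide) (by decide)
  have k4 := key 0 2 1 3 (by decide) (by decide) (by decide)
  have k5 := key 0 2 1 4 (by decide) (by decide) (by decide)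
  have k6 := key 0 2 3 4 (by decide) (by decide) (by decide)
  have k7 := key 0 3 1 2 (by decide) (by decide) (by decide)
  have k8 := key 0 3 1 4 (by decide) (by decide) (by decide)
  have k9 := key 0 3 2 4 (by decide) (by decide) (by decide)
  have k10 := key 0 4 1 2 (by decide) (by decide) (by decide)
  have k11 := key 0 4 1 3 (by decide) (by decide) (by decide)
  have k12 := key 0 4 2 3 (by decide) (by decide) (by decide)
  have k13 := key 1 2 3 4 (by decide) (by decide) (by decide)
  have k14 := key 1 3 2 4 (by decide) (by decide) (by decide)
  have k15 := key 1 4 2 3 (by decide) (by decide) (by decide)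
  -- In the sum over the fifteen independent pairs each term `φ (L i j) (p k)` occurs twice, because
  -- two edges at k avoid both i and j. Hence all corrections vanish modulo 2.
  have hone : (1 : ZMod 2) = 0 := by
    linear_combination k1 + k2 + k3 + k4 + k5 + k6 + k7 + k8 + k9 + k10 + k11 + k12 + k13 +
      k14 + k15 - hsum - two * (
        φ (L 0 1) (p 2) + φ (L 0 1) (p 3) + φ (L 0 1) (p 4) +
        φ (L 0 2) (p 1) + φ (L 0 2) (p 3) + φ (L 0 2) (p 4) +
        φ (L 0 3) (p 1) + φ (L 0 3) (p 2) + φ (L 0 3) (p 4) +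
        φ (L 0 4) (p 1) + φ (L 0 4) (p 2) + φ (L 0 4) (p 3) +
        φ (L 1 2) (p 0) + φ (L 1 2) (p 3) + φ (L 1 2) (p 4) +
        φ (L 1 3) (p 0) + φ (L 1 3) (p 2) + φ (L 1 3) (p 4) +
        φ (L 1 4) (p 0) + φ (L 1 4) (p 2) + φ (L 1 4) (p 3) +
        φ (L 2 3) (p 0) + φ (L 2 3) (p 1) + φ (L 2 3) (p 4) +
        φ (L 2 4) (p 0) + φ (L 2 4) (p 1) + φ (L 2 4) (p 3) +
        φ (L 3 4) (p 0) + φ (L 3 4) (p 1) + φ (L 3 4) (p 2))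
  exact absurd hone (by decide)

end LabelLine

/-! ### From polygonal lines to compact connected sets -/

lemma exists_mem_segment_of_segCross {a b c d : Plane} (h : segCross a b c d ≠ 0) :
    ∃ x, x ∈ segment ℝ a b ∧ x ∈ segment ℝ c d := by
  have hpar : ∀ x y : Bool, parity (x && y) ≠ 0 → x = true ∧ y = true := by decide
  obtain ⟨h1, h2⟩ := hpar _ _ h
  -- The quotient is the zero of the affine function with values u at 0 and v at 1. Applied to the
  -- orientations, it locates the common point on each segment.
  have ratio (u v : ℝ) (huv : (decide (0 < u) ^^ decide (0 < v)) = true) :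
      u - v ≠ 0 ∧ 0 ≤ u / (u - v) ∧ u / (u - v) ≤ 1 := by
    rcases lt_or_ge 0 u with hu | hu <;> rcases lt_or_ge 0 v with hv | hv
    · simp [hu, hv] at huv
    · have : 0 < u - v := by linarith
      exact ⟨this.ne', by positivity, (div_le_one this).2 (by linarith)⟩
    · have : u - v < 0 := by linarith
      exact ⟨this.ne, div_nonneg_of_nonpos hu this.le, (div_le_one_of_neg this).2 (by linarith)⟩
    · simp [not_lt.2 hu, not_lt.2 hv] at huv
  obtain ⟨n1, l1, u1⟩ := ratio (orient a b c) (orient a b d) (by simpa [orientSign] using h1)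
  obtain ⟨n2, l2, u2⟩ := ratio (orient c d a) (orient c d b) (by simpa [orientSign] using h2)
  refine ⟨AffineMap.lineMap a b (orient c d a / (orient c d a - orient c d b)), ?_, ?_⟩
  · rw [segment_eq_image_lineMap]
    exact ⟨_, ⟨l2, u2⟩, rfl⟩
  · rw [segment_eq_image_lineMap]
    refine ⟨orient a b c / (orient a b c - orient a b d), ⟨l1, u1⟩, ?_⟩
    ext i
    simp only [AffineMap.lineMap_apply, vsub_eq_sub, vadd_eq_add, PiLp.add_apply, PiLp.smul_apply,
      PiLp.sub_apply, smul_eq_mul]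
    unfold orient at *
    fin_cases i <;> simp <;> field_simp <;> ring

/-- Points can be moved into general position by an arbitrarily small amount. -/
lemma exists_inGeneralPosition {ι : Type*} [Countable ι] (q₀ : ι → Plane) {η : ℝ} (hη : 0 < η) :
    ∃ q : ι → Plane, (∀ i, dist (q i) (q₀ i) ≤ η) ∧ InGeneralPosition q := by
  obtain ⟨e, he⟩ := exists_injective_nat ι
  let t : ι → ℝ := fun i => 1 / ((e i : ℝ) + 1)
  have ht : Function.Injective t := by
    intro i j hij
    simp only [t, one_div, inv_inj, add_left_inj, Nat.cast_inj] at hij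
    exact he hij
  have ht0 (i) : 0 ≤ t i := by positivity
  have ht1 (i) : t i ≤ 1 := by
    simp only [t]
    rw [div_le_one (by positivity)]
    linarith [(Nat.cast_nonneg (e i) : (0 : ℝ) ≤ e i)]
  -- The points are moved along a parabola. For each triple the orientation is a quadratic
  -- polynomial in `s` whose leading coefficient is a Vandermonde determinant, so only countably
  -- many `s` are bad.
  let q : ℝ → ι → Plane := fun s i => q₀ i + s • !₂[t i, t i ^ 2]
  let bad : Set ℝ := ⋃ x : {x : ι × ι × ι // x.1 ≠ x.2.1 ∧ x.1 ≠ x.2.2 ∧ x.2.1 ≠ x.2.2},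
    {s | orient (q s x.1.1) (q s x.1.2.1) (q s x.1.2.2) = 0}
  have hbad : bad.Countable := by
    refine Set.countable_iUnion fun ⟨⟨i, j, k⟩, hij, hik, hjk⟩ => Set.Finite.countable ?_
    let B : ℝ := (q₀ j 0 - q₀ i 0) * (t k ^ 2 - t i ^ 2) + (t j - t i) * (q₀ k 1 - q₀ i 1) -
      (q₀ j 1 - q₀ i 1) * (t k - t i) - (t j ^ 2 - t i ^ 2) * (q₀ k 0 - q₀ i 0)
    let C : ℝ := (t j - t i) * (t k - t i) * (t k - t j)
    have hC : C ≠ 0 := mul_ne_zero (mul_ne_zero (sub_ne_zero.2 (ht.ne hij.symm))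
      (sub_ne_zero.2 (ht.ne hik.symm))) (sub_ne_zero.2 (ht.ne hjk.symm))
    let P : Polynomial ℝ := Polynomial.C C * Polynomial.X ^ 2 + Polynomial.C B * Polynomial.X +
      Polynomial.C (orient (q₀ i) (q₀ j) (q₀ k))
    have hP : P ≠ 0 := by
      intro h
      have := congrArg (fun p => Polynomial.coeff p 2) h
      simp [P] at this
      exact hC this
    refine (Polynomial.finite_setOfPred_isRoot hP).subset fun s hs => ?_
    rw [Set.mem_ofPred_eq] at hs ⊢
    rw [Polynomial.IsRoot.def, ← hs]
    simp [P, B, C, q, orient]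
    ring
  obtain ⟨s, ⟨hs0, hs1⟩, hs⟩ := (hbad.dense_compl ℝ).inter_open_nonempty (Set.Ioo 0 (η / 2))
    isOpen_Ioo ⟨η / 4, by constructor <;> linarith⟩
  refine ⟨q s, fun i => ?_, fun i j k hij hik hjk h => hs ?_⟩
  · simp only [q, dist_eq_norm, add_sub_cancel_left, norm_smul, Real.norm_eq_abs, abs_of_pos hs0]
    have : ‖(!₂[t i, t i ^ 2] : Plane)‖ ≤ 2 := by
      rw [EuclideanSpace.norm_eq]
      refine Real.sqrt_le_iff.2 ⟨by norm_num, ?_⟩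
      simp only [Fin.sum_univ_two, Real.norm_eq_abs, sq_abs]
      simp
      nlinarith [ht0 i, ht1 i, pow_le_one₀ (n := 2) (ht0 i) (ht1 i),
        pow_le_one₀ (n := 4) (ht0 i) (ht1 i)]
    nlinarith
  · exact Set.mem_iUnion.2 ⟨⟨(i, j, k), hij, hik, hjk⟩, h⟩

/-- Two points of a connected set are joined by a chain of points of the set with small gaps. -/
lemma IsPreconnected.exists_chain {A : Set Plane} (hA : IsPreconnected A) {x y : Plane}
    (hx : x ∈ A) (hy : y ∈ A) {η : ℝ} (hη : 0 < η) :
    ∃ (n : ℕ) (c : ℕ → Plane), c 0 = x ∧ c n = y ∧ (∀ k ≤ n, c k ∈ A) ∧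
      ∀ k < n, dist (c k) (c (k + 1)) < η := by
  have h : Relation.ReflTransGen (fun a b => a ∈ A ∧ b ∈ A ∧ dist a b < η) x y := by
    refine hA.induction₂' (Relation.ReflTransGen (fun a b => a ∈ A ∧ b ∈ A ∧ dist a b < η))
      (fun a ha => ?_) (fun a b c _ _ _ h1 h2 => h1.trans h2) hx hy
    filter_upwards [self_mem_nhdsWithin, mem_nhdsWithin_of_mem_nhds (Metric.ball_mem_nhds a hη)]
      with b hb hab
    exact ⟨.single ⟨ha, hb, by rwa [dist_comm]⟩, .single ⟨hb, ha, hab⟩⟩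
  clear hx
  induction h using Relation.ReflTransGen.head_induction_on with
  | refl => exact ⟨0, fun _ => y, rfl, rfl, fun _ _ => hy, by simp⟩
  | @head a b hab _ ih =>
    obtain ⟨n, c, h0, hn, hmem, hstep⟩ := ih
    refine ⟨n + 1, fun k => Nat.casesOn k a c, rfl, hn, ?_, ?_⟩
    · rintro (_ | k) hk
      · exact hab.1
      · exact hmem k (by lia)
    · rintro (_ | k) hk
      · simpa [h0] using hab.2.2
      · exact hstep k (by lia)

/-- Any polygonal line along a connected set, with labels of its own. -/
lemma exists_labelLine {A : Set Plane} (hA : IsPreconnected A) {p : Fin 5 → Plane} {i j : Fin 5}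
    (hij : i ≠ j) (hi : p i ∈ A) (hj : p j ∈ A) {η : ℝ} (hη : 0 < η) :
    ∃ (c : ℕ → Plane) (L : LabelLine (Fin 5 ⊕ (Fin 5 × Fin 5 × ℕ))),
      L.first = .inl i ∧ L.last = .inl j ∧
      (∀ a ≤ L.length, L.vertex a = .inl i ∨ L.vertex a = .inl j ∨ ∃ k, L.vertex a = .inr
        (i, j, k)) ∧
      ∀ q : Fin 5 ⊕ (Fin 5 × Fin 5 × ℕ) → Plane, (∀ i, q (.inl i) = p i) →
        (∀ k, q (.inr (i, j, k)) = c k) →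
        (∀ a ≤ L.length, q (L.vertex a) ∈ A) ∧
        ∀ a < L.length, dist (q (L.vertex a)) (q (L.vertex (a + 1))) < η := by
  obtain ⟨n, c, h0, hn, hmem, hstep⟩ := hA.exists_chain hi hj hη
  -- There are n + 1 segments: `c n` occurs under its own label (if n > 0) and again as the end `inl
  -- j`. So the length is positive even if n = 0, and labels stay distinct where the chain repeats
  -- points.
  let v : ℕ → Fin 5 ⊕ (Fin 5 × Fin 5 × ℕ) := fun k =>
    if k = 0 then .inl i else if k = n + 1 then .inl j else .inr (i, j, k)
  have hv : Set.InjOn v (Set.Iic (n + 1)) := by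
    intro a _ b _ hab
    simp only [v] at hab
    split_ifs at hab <;> simp_all
  refine ⟨c, ⟨v, n + 1, by lia, hv⟩, by simp [LabelLine.first, v], by simp [LabelLine.last, v],
    ?_, ?_⟩
  · intro a _
    simp only [v]
    split_ifs <;> simp
  · intro q hp hc
    have hq : ∀ a ≤ n + 1, q (v a) = c (min a n) := by
      intro a ha
      simp only [v]
      split_ifs with h1 h2
      · simp [h1, hp, h0]
      · simp [h2, hp, hn]
      · rw [hc, min_eq_left (by lia)]
    refine ⟨fun a ha => ?_, fun a ha => ?_⟩
    · change q (v a) ∈ A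
      rw [hq a ha]
      exact hmem _ (min_le_right _ _)
    · change dist (q (v a)) (q (v (a + 1))) < η
      change a < n + 1 at ha
      rw [hq a ha.le, hq (a + 1) ha]
      rcases (Nat.lt_succ_iff.1 ha).lt_or_eq with h | rfl
      · rw [min_eq_left h.le, min_eq_left h]
        exact hstep a h
      · simpa using hη

/-- The complete graph on five vertices cannot be drawn in the plane, even if edges with a common
end are allowed to meet: two independent edges meet. -/
theorem exists_inter_nonempty_of_five (p : Fin 5 → Plane) (A : Fin 5 → Fin 5 → Set Plane)
    (hcpt : ∀ i j, i < j → IsCompact (A i j)) (hconn : ∀ i j, i < j → IsPreconnected (A i j))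
    (hleft : ∀ i j, i < j → p i ∈ A i j) (hright : ∀ i j, i < j → p j ∈ A i j) :
    ∃ i j k l, i < j ∧ k < l ∧ [i, j, k, l].Nodup ∧ (A i j ∩ A k l).Nonempty := by
  by_contra! H
  have hδ : ∀ i j k l, ∀ᶠ δ in nhdsWithin (0 : ℝ) (Set.Ioi 0), i < j → k < l → [i, j, k, l].Nodup →
      ∀ x ∈ A i j, ∀ y ∈ A k l, δ < dist x y := by
    intro i j k l
    by_cases h : i < j ∧ k < l ∧ [i, j, k, l].Nodup
    · obtain ⟨δ, hδ, hlt⟩ := Metric.exists_pos_forall_lt_edist (hcpt i j h.1)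
        (hcpt k l h.2.1).isClosed (Set.disjoint_iff_inter_eq_empty.2 (H i j k l h.1 h.2.1 h.2.2))
      filter_upwards [Ioo_mem_nhdsGT (NNReal.coe_pos.2 hδ)] with ε hε _ _ _ x hx y hy
      have := hlt x hx y hy
      rw [edist_nndist] at this
      refine hε.2.trans ?_
      exact_mod_cast this
    · exact .of_forall fun ε h1 h2 h3 => absurd ⟨h1, h2, h3⟩ h
  obtain ⟨δ, hδ, hδ0⟩ := ((Filter.eventually_all.2 fun i => Filter.eventually_all.2 fun j =>
    Filter.eventually_all.2 fun k => Filter.eventually_all.2 fun l => hδ i j k l).and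
    self_mem_nhdsWithin).exists
  -- Chain gaps and perturbations are both at most δ/8, so a crossing point is within δ/4 of a chain
  -- point of either set. Independent sets are more than δ apart.
  have hη : 0 < δ / 8 := by positivity
  have hL : ∀ i j, ∃ (c : ℕ → Plane) (L : LabelLine (Fin 5 ⊕ (Fin 5 × Fin 5 × ℕ))), i < j →
      L.first = .inl i ∧ L.last = .inl j ∧
      (∀ a ≤ L.length, L.vertex a = .inl i ∨ L.vertex a = .inl j ∨ ∃ k, L.vertex a = .inr
        (i, j, k)) ∧
      ∀ q : Fin 5 ⊕ (Fin 5 × Fin 5 × ℕ) → Plane, (∀ i, q (.inl i) = p i) →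
        (∀ k, q (.inr (i, j, k)) = c k) →
        (∀ a ≤ L.length, q (L.vertex a) ∈ A i j) ∧
        ∀ a < L.length, dist (q (L.vertex a)) (q (L.vertex (a + 1))) < δ / 8 := by
    intro i j
    by_cases h : i < j
    · obtain ⟨c, L, hcL⟩ := exists_labelLine (hconn i j h) h.ne (hleft i j h) (hright i j h) hη
      exact ⟨c, L, fun _ => hcL⟩
    · obtain ⟨c, L, -⟩ := exists_labelLine (hconn 0 1 (by decide)) (by decide)
        (hleft 0 1 (by decide)) (hright 0 1 (by decide)) hη
      exact ⟨c, L, fun h' => absurd h' h⟩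
  choose c L hcL using hL
  let q₀ : Fin 5 ⊕ (Fin 5 × Fin 5 × ℕ) → Plane := Sum.elim p fun x => c x.1 x.2.1 x.2.2
  obtain ⟨q, hq, hgen⟩ := exists_inGeneralPosition q₀ hη
  obtain ⟨i, j, k, l, hij, hkl, hnd, hcr⟩ := LabelLine.exists_cross_ne_zero hgen
    Sum.inl_injective (L := L) (fun i j h => (hcL i j h).1) (fun i j h => (hcL i j h).2.1) (by
      intro i j k l hij hkl hnd a ha b hb
      simp only [List.nodup_cons, List.mem_cons, List.not_mem_nil, or_false, not_or] at hnd
      rcases (hcL i j hij).2.2.1 a ha with h | h | ⟨_, h⟩ <;>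
      rcases (hcL k l hkl).2.2.1 b hb with h' | h' | ⟨_, h'⟩ <;> rw [h, h'] <;> simp <;> tauto)
  rw [LabelLine.cross, polyCross] at hcr
  obtain ⟨a, ha, hcr⟩ := exists_ne_zero_of_sum_ne_zero hcr
  obtain ⟨b, hb, hcr⟩ := exists_ne_zero_of_sum_ne_zero hcr
  rw [mem_range] at ha hb
  obtain ⟨x, hx1, hx2⟩ := exists_mem_segment_of_segCross hcr
  have close (i j : Fin 5) (hij : i < j) (a : ℕ) (ha : a < (L i j).length)
      (hx : x ∈ segment ℝ (q ((L i j).vertex a)) (q ((L i j).vertex (a + 1)))) :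
      q₀ ((L i j).vertex a) ∈ A i j ∧ dist x (q₀ ((L i j).vertex a)) ≤ 2 * (δ / 8) := by
    obtain ⟨h1, h2⟩ := (hcL i j hij).2.2.2 q₀ (fun _ => rfl) (fun _ => rfl)
    refine ⟨h1 a ha.le, ?_⟩
    refine (convex_closedBall (q₀ ((L i j).vertex a)) (2 * (δ / 8))).segment_subset ?_ ?_ hx
    · rw [Metric.mem_closedBall]
      linarith [hq ((L i j).vertex a)]
    · rw [Metric.mem_closedBall]
      have := dist_triangle (q ((L i j).vertex (a + 1))) (q₀ ((L i j).vertex (a + 1)))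
        (q₀ ((L i j).vertex a))
      have := h2 a ha
      rw [dist_comm] at this
      linarith [hq ((L i j).vertex (a + 1))]
  obtain ⟨m1, d1⟩ := close i j hij a ha hx1
  obtain ⟨m2, d2⟩ := close k l hkl b hb hx2
  have := hδ i j k l hij hkl hnd _ m1 _ m2
  have := dist_triangle_left (q₀ ((L i j).vertex a)) (q₀ ((L k l).vertex b)) x
  linarith

/-! ### Four pairwise linked vertices from minimum degree three -/

section

variable {V : Type*} {G : SimpleGraph V}

/-- The vertices `f 0, …, f n` form a path of `G` inside `S`. -/
structure IsVertexPath (G : SimpleGraph V) (S : Set V) (n : ℕ) (f : ℕ → V) : Prop where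
  injOn : Set.InjOn f (Set.Iic n)
  mem : ∀ a ≤ n, f a ∈ S
  adj : ∀ a < n, G.Adj (f a) (f (a + 1))

namespace IsVertexPath

variable {S : Set V} {n : ℕ} {f : ℕ → V}

/-- The path obtained by reversing the part in front of a neighbour of the first vertex. -/
lemma rotate (h : IsVertexPath G S n f) {i : ℕ} (hi0 : 0 < i) (hi : i ≤ n)
    (hadj : G.Adj (f 0) (f i)) :
    IsVertexPath G S n fun t => if t < i then f (i - 1 - t) else f t := by
  refine ⟨fun a ha b hb hab => ?_, fun a ha => ?_, fun a ha => ?_⟩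
  · rw [Set.mem_Iic] at ha hb
    have inj (x y : ℕ) (hx : x ≤ n) (hy : y ≤ n) (hxy : f x = f y) : x = y := h.injOn hx hy hxy
    split_ifs at hab <;> have := inj _ _ (by lia) (by lia) hab <;> lia
  · split_ifs
    · exact h.mem _ (by lia)
    · exact h.mem _ ha
  · split_ifs with h1 h2
    · have := h.adj (i - 1 - (a + 1)) (by lia)
      rw [show i - 1 - (a + 1) + 1 = i - 1 - a by lia] at this
      exact this.symm
    · rwa [show i - 1 - a = 0 by lia, show a + 1 = i by lia]
    · lia
    · exact h.adj a ha

lemma cons (h : IsVertexPath G S n f) {w : V} (hw : w ∈ S) (hadj : G.Adj (f 0) w)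
    (hnot : ∀ a ≤ n, f a ≠ w) : IsVertexPath G S (n + 1) fun t => Nat.casesOn t w f := by
  refine ⟨?_, ?_, ?_⟩
  · rintro (_ | a) ha (_ | b) hb hab
    · rfl
    · exact absurd hab.symm (hnot b (Nat.succ_le_succ_iff.1 hb))
    · exact absurd hab (hnot a (Nat.succ_le_succ_iff.1 ha))
    · exact congrArg _ (h.injOn (Nat.succ_le_succ_iff.1 ha) (Nat.succ_le_succ_iff.1 hb) hab)
  · rintro (_ | a) ha
    · exact hw
    · exact h.mem a (Nat.succ_le_succ_iff.1 ha)
  · rintro (_ | a) ha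
    · exact hadj.symm
    · exact h.adj a (Nat.succ_lt_succ_iff.1 ha)

lemma length_lt [Finite V] (h : IsVertexPath G S n f) : n < Nat.card V := by
  have : Function.Injective fun k : Fin (n + 1) => f k := fun a b hab =>
    Fin.ext (h.injOn (Nat.lt_succ_iff.1 a.2) (Nat.lt_succ_iff.1 b.2) hab)
  simpa using Nat.card_le_card_of_injective _ this

/-- A walk along a part of a path. -/
lemma exists_walk (h : IsVertexPath G S n f) {a b : ℕ} (hab : a ≤ b) (hb : b ≤ n) :
    ∃ w : G.Walk (f a) (f b), ∀ x ∈ w.support, ∃ t, a ≤ t ∧ t ≤ b ∧ f t = x := by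
  induction b, hab using Nat.le_induction with
  | base => exact ⟨.nil, fun x hx => ⟨a, le_rfl, le_rfl, by simpa [eq_comm] using hx⟩⟩
  | succ b hab ih =>
    obtain ⟨w, hw⟩ := ih (by lia)
    refine ⟨w.concat (h.adj b hb), fun x hx => ?_⟩
    rw [SimpleGraph.Walk.support_concat, List.mem_append] at hx
    rcases hx with hx | hx
    · obtain ⟨t, h1, h2, h3⟩ := hw x hx
      exact ⟨t, h1, by lia, h3⟩
    · exact ⟨b + 1, by lia, le_rfl, by simpa [eq_comm] using hx⟩

/-- A walk that enters a path by an edge and follows it backwards. -/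
lemma exists_walk_of_adj (h : IsVertexPath G S n f) {e a b : ℕ} (hab : a ≤ b) (hb : b ≤ n)
    (hadj : G.Adj (f e) (f b)) :
    ∃ w : G.Walk (f e) (f a), ∀ x ∈ w.support, x = f e ∨ ∃ t, a ≤ t ∧ t ≤ b ∧ f t = x := by
  obtain ⟨w, hw⟩ := h.exists_walk hab hb
  refine ⟨.cons hadj w.reverse, fun x hx => ?_⟩
  rw [SimpleGraph.Walk.support_cons, List.mem_cons, SimpleGraph.Walk.support_reverse,
    List.mem_reverse] at hx
  exact hx.imp_right (hw x)

end IsVertexPath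

/-- If every vertex of `S` has at least three neighbours in `S`, then there are four vertices that
are joined pairwise by walks such that walks without a common end are disjoint. -/
theorem exists_walks_of_three_neighbors [Finite V] {S : Set V} (hne : S.Nonempty)
    (hdeg : ∀ v ∈ S, ∀ x y, ∃ w ∈ S, G.Adj v w ∧ w ≠ x ∧ w ≠ y) :
    ∃ (a b c d : V) (ab : G.Walk a b) (cd : G.Walk c d) (ac : G.Walk a c) (bd : G.Walk b d)
      (ad : G.Walk a d) (bc : G.Walk b c), ab.support.Disjoint cd.support ∧
      ac.support.Disjoint bd.support ∧ ad.support.Disjoint bc.support := by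
  obtain ⟨v₀, hv₀⟩ := hne
  let lengths : Set ℕ := {n | ∃ f, IsVertexPath G S n f}
  have hbdd : BddAbove lengths := ⟨Nat.card V, fun n ⟨f, hf⟩ => hf.length_lt.le⟩
  have hzero : 0 ∈ lengths := by
    refine ⟨fun _ => v₀, fun a ha b hb _ => ?_, fun _ _ => hv₀, by simp⟩
    rw [Set.mem_Iic] at ha hb
    lia
  obtain ⟨n, ⟨f₁, hf₁⟩, hmax⟩ : ∃ n, (∃ f, IsVertexPath G S n f) ∧
      ∀ m, (∃ f, IsVertexPath G S m f) → m ≤ n :=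
    ⟨sSup lengths, Nat.sSup_mem ⟨0, hzero⟩ hbdd, fun m hm => le_csSup hbdd hm⟩
  -- All neighbours in `S` of the first vertex of a longest path lie on the path, since otherwise
  -- `cons` would lengthen it.
  have nbr (f : ℕ → V) (hf : IsVertexPath G S n f) (i : ℕ) :
      ∃ k, 2 ≤ k ∧ k ≤ n ∧ k ≠ i ∧ G.Adj (f 0) (f k) := by
    obtain ⟨w, hwS, hadj, h1, hi⟩ := hdeg (f 0) (hf.mem 0 (Nat.zero_le _)) (f 1) (f i)
    by_contra! hk
    refine absurd (hmax _ ⟨_, hf.cons hwS hadj fun a ha haw => ?_⟩) (by lia)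
    subst haw
    rcases Nat.lt_or_ge a 2 with h2 | h2
    · interval_cases a
      · exact G.irrefl hadj
      · exact h1 rfl
    · exact hk a h2 ha (fun h => hi (h ▸ rfl)) hadj
  have hex : ∃ i, 2 ≤ i ∧ i ≤ n ∧ ∃ f, IsVertexPath G S n f ∧ G.Adj (f 0) (f i) := by
    obtain ⟨k, h1, h2, -, h3⟩ := nbr f₁ hf₁ 0
    exact ⟨k, h1, h2, f₁, hf₁, h3⟩
  classical
  -- The index `i` is minimal over all longest paths at once, so that minimality also applies to the
  -- rotated path, which starts at `f (i - 1)`.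
  obtain ⟨i, ⟨hi2, hin, f, hf, hadj⟩, hmin⟩ : ∃ i, (2 ≤ i ∧ i ≤ n ∧ ∃ f, IsVertexPath G S n f ∧
      G.Adj (f 0) (f i)) ∧ ∀ j, (2 ≤ j ∧ j ≤ n ∧ ∃ f, IsVertexPath G S n f ∧
      G.Adj (f 0) (f j)) → i ≤ j :=
    ⟨Nat.find hex, Nat.find_spec hex, fun j hj => Nat.find_min' hex hj⟩
  have far (g : ℕ → V) (hg : IsVertexPath G S n g) : ∃ j, i < j ∧ j ≤ n ∧ G.Adj (g 0) (g j) := by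
    obtain ⟨k, h1, h2, h3, h4⟩ := nbr g hg i
    exact ⟨k, lt_of_le_of_ne (hmin k ⟨h1, h2, g, hg, h4⟩) h3.symm, h2, h4⟩
  obtain ⟨j, hij, hjn, hj⟩ := far f hf
  obtain ⟨m, him, hmn, hm⟩ := far _ (hf.rotate (by lia) hin hadj)
  simp only [show 0 < i by lia, if_true, not_lt.2 him.le, if_false, Nat.sub_zero] at hm
  have ne (a b : ℕ) (ha : a ≤ n) (hb : b ≤ n) (hab : a ≠ b) : f a ≠ f b :=
    fun h => hab (hf.injOn ha hb h)
  obtain ⟨ab, hab⟩ := hf.exists_walk (a := 0) (b := i - 1) (by lia) (by lia)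
  obtain ⟨cd, hcd⟩ := hf.exists_walk (a := i) (b := min j m) (by lia) (by lia)
  -- The fourth vertex is the nearer of `f j` and `f m`. One of the walks to it is a single edge,
  -- and the other returns along the path, beyond `f i`.
  obtain ⟨ad, had⟩ := hf.exists_walk_of_adj (a := min j m) (b := j) (by lia) hjn hj
  obtain ⟨bd, hbd⟩ := hf.exists_walk_of_adj (a := min j m) (b := m) (by lia) hmn hm
  have hbc : G.Adj (f (i - 1)) (f i) := by
    have := hf.adj (i - 1) (by lia)
    rwa [Nat.sub_add_cancel (by lia)] at this
  refine ⟨f 0, f (i - 1), f i, f (min j m), ab, cd, hadj.toWalk, bd, ad, hbc.toWalk, ?_, ?_, ?_⟩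
  · intro x h1 h2
    obtain ⟨t, ht, ht', rfl⟩ := hab x h1
    obtain ⟨u, hu, hu', hx⟩ := hcd _ h2
    exact ne u t (by lia) (by lia) (by lia) hx
  · intro x h1 h2
    simp only [SimpleGraph.Adj.support_toWalk, List.mem_cons, List.not_mem_nil, or_false] at h1
    rcases hbd _ h2 with rfl | ⟨t, ht, ht', rfl⟩ <;> rcases h1 with h1 | h1 <;>
      exact ne _ _ (by lia) (by lia) (by lia) h1
  · intro x h1 h2
    simp only [SimpleGraph.Adj.support_toWalk, List.mem_cons, List.not_mem_nil, or_false] at h2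
    rcases had _ h1 with rfl | ⟨t, ht, ht', rfl⟩ <;> rcases h2 with h2 | h2 <;>
      exact ne _ _ (by lia) (by lia) (by lia) h2

end

/-! ### Separating path systems of 2-degenerate graphs -/

section

variable {V : Type*} {G : SimpleGraph V}

/-- The two ends of a path. -/
def GraphPath.ending (P : GraphPath G) (b : Bool) : V := bif b then P.2.1 else P.1

/-- The vertices of a path. -/
def GraphPath.support (P : GraphPath G) : List V := P.2.2.val.support

/-- A path can be extended at either end. -/
lemma GraphPath.exists_extend (P : GraphPath G) (b : Bool) {w : V} (h : G.Adj (P.ending b) w)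
    (hw : w ∉ P.support) :
    ∃ P' : GraphPath G, P'.ending b = w ∧ P'.ending (!b) = P.ending (!b) ∧
      (∀ e, P'.Contains e ↔ e = s(P.ending b, w) ∨ P.Contains e) ∧
      ∀ x, x ∈ P'.support ↔ x = w ∨ x ∈ P.support := by
  obtain ⟨u, v, p, hp⟩ := P
  cases b
  · replace h : G.Adj u w := h
    refine ⟨⟨w, v, .cons h.symm p, hp.cons hw⟩, rfl, rfl, fun e => ?_, fun x => ?_⟩
    · simp [GraphPath.Contains, ending, Sym2.eq_swap]
    · simp [support]
  · replace h : G.Adj v w := h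
    refine ⟨⟨u, w, p.concat h, hp.concat hw h⟩, rfl, rfl, fun e => ?_, fun x => ?_⟩
    · simp [GraphPath.Contains, ending, or_comm, SimpleGraph.Walk.edges_concat]
    · simp [support, or_comm, SimpleGraph.Walk.support_concat]

lemma GraphPath.Contains.mem_support {P : GraphPath G} {e : Sym2 V} (h : P.Contains e) {x : V}
    (hx : x ∈ e) : x ∈ P.support := by
  induction e with
  | _ a b =>
    rcases Sym2.mem_iff.1 hx with rfl | rfl
    · exact P.2.2.val.fst_mem_support_of_mem_edges h
    · exact P.2.2.val.snd_mem_support_of_mem_edges h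

/-- A family of paths inside `S` that strongly separates the edges inside `S` and contains each of
them at least twice, such that every vertex of `S` is an end of two paths (or both ends of a
trivial path). -/
structure IsPathFamily (G : SimpleGraph V) (S : Finset V) {ι : Type*} (P : ι → GraphPath G) :
    Prop where
  support_subset : ∀ i, ∀ x ∈ (P i).support, x ∈ S
  ends : ∀ v ∈ S, ∃ x y : ι × Bool, x ≠ y ∧ (P x.1).ending x.2 = v ∧ (P y.1).ending y.2 = v
  twice : ∀ e ∈ G.edgeSet, (∀ x ∈ e, x ∈ S) → ∃ i j, i ≠ j ∧ (P i).Contains e ∧ (P j).Contains e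
  separates : ∀ e ∈ G.edgeSet, ∀ f ∈ G.edgeSet, (∀ x ∈ e, x ∈ S) → (∀ x ∈ f, x ∈ S) → e ≠ f →
    ∃ i, (P i).Contains e ∧ ¬ (P i).Contains f

/-- Adding a vertex `v` with neighbourhood `N`: for every neighbour a path that ends there is
extended to `v`, and a path that consists of the edges at `v` is added. -/
lemma IsPathFamily.insert_vertex [DecidableEq V] {S N : Finset V} {ι : Type*} {P : ι → GraphPath G}
    (h : IsPathFamily G S P) {v : V} (hv : v ∉ S) (hNS : N ⊆ S) (hN : ∀ u ∈ S, G.Adj v u ↔ u ∈ N)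
    (x : N → ι × Bool) (hx : ∀ a : N, (P (x a).1).ending (x a).2 = a)
    (hinj : ∀ a b : N, (x a).1 = (x b).1 → a = b) (Q : GraphPath G)
    (hQ : ∀ e, Q.Contains e ↔ ∃ a ∈ N, e = s(a, v)) (hQS : ∀ u ∈ Q.support, u ∈ insert v S)
    (hQN : ∀ a ∈ N, ∃ c, Q.ending c = a)
    (hQv : ∃ y z : Option ι × Bool, y ≠ z ∧ ∀ w : Option ι × Bool, w = y ∨ w = z →
      (w.1 = none ∧ Q.ending w.2 = v) ∨ ∃ a : N, w = (some (x a).1, (x a).2)) :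
    ∃ P' : Option ι → GraphPath G, IsPathFamily G (insert v S) P' := by
  have hvP (i : ι) : v ∉ (P i).support := fun hi => hv (h.support_subset i v hi)
  have hvE (i : ι) (a : V) : ¬ (P i).Contains s(a, v) :=
    fun hi => hvP i (hi.mem_support (Sym2.mem_mk_right _ _))
  -- `R` is `P i`, extended to `v` if some neighbour has selected one of its ends. By `hinj` at most
  -- one neighbour does.
  have hR : ∀ i, ∃ R : GraphPath G,
      (∀ e, v ∉ e → (R.Contains e ↔ (P i).Contains e)) ∧
      (∀ a : N, R.Contains s(↑a, v) ↔ (x a).1 = i) ∧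
      (∀ u ∈ R.support, u ∈ insert v S) ∧
      (∀ b, (∀ a : N, x a ≠ (i, b)) → R.ending b = (P i).ending b) ∧
      (∀ a : N, (x a).1 = i → R.ending (x a).2 = v) := by
    intro i
    by_cases hi : ∃ a : N, (x a).1 = i
    · obtain ⟨a, rfl⟩ := hi
      have hadj : G.Adj ((P (x a).1).ending (x a).2) v := by
        rw [hx a]
        exact ((hN a (hNS a.2)).2 a.2).symm
      obtain ⟨R, h1, h2, h3, h4⟩ := (P (x a).1).exists_extend (x a).2 hadj (hvP _)
      rw [hx a] at h3
      refine ⟨R, fun e he => ?_, fun b => ?_, fun u hu => ?_, fun b hb => ?_, fun b hab => ?_⟩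
      · rw [h3]
        refine or_iff_right ?_
        rintro rfl
        exact he (Sym2.mem_mk_right _ _)
      · rw [h3]
        constructor
        · rintro (hab | hab)
          · rw [Subtype.ext (Sym2.congr_left.1 hab)]
          · exact absurd hab (hvE _ _)
        · intro hab
          rw [hinj b a hab]
          exact .inl rfl
      · rcases (h4 u).1 hu with rfl | hu
        · exact mem_insert_self _ _
        · exact mem_insert_of_mem (h.support_subset _ u hu)
      · have : b = !(x a).2 := by
          rw [Bool.eq_not]
          rintro rfl
          exact hb a rfl
        rw [this, h2]
      · rw [hinj b a hab, h1]
    · push Not at hi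
      exact ⟨P i, fun _ _ => Iff.rfl, fun a => iff_of_false (hvE i a) (hi a),
        fun u hu => mem_insert_of_mem (h.support_subset i u hu), fun _ _ => rfl,
        fun a hai => absurd hai (hi a)⟩
  choose R hRold hRnew hRsupp hRend hRv using hR
  have edge_cases (e : Sym2 V) (he : e ∈ G.edgeSet) (heS : ∀ u ∈ e, u ∈ insert v S) :
      (v ∉ e ∧ ∀ u ∈ e, u ∈ S) ∨ ∃ a ∈ N, e = s(a, v) := by
    by_cases hve : v ∈ e
    · right
      obtain ⟨a, rfl⟩ := hve
      have hne : a ≠ v := he.ne'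
      have haS : a ∈ S := (mem_insert.1 (heS a (Sym2.mem_mk_right _ _))).resolve_left hne
      exact ⟨a, (hN a haS).1 he, Sym2.eq_swap⟩
    · refine .inl ⟨hve, fun u hu => (mem_insert.1 (heS u hu)).resolve_left ?_⟩
      rintro rfl
      exact hve hu
  have hQold (e : Sym2 V) (he : v ∉ e) : ¬ Q.Contains e := by
    rw [hQ]
    rintro ⟨a, -, rfl⟩
    exact he (Sym2.mem_mk_right _ _)
  refine ⟨fun o => o.elim Q R, ?_, ?_, ?_, ?_⟩
  · rintro (_ | i) u hu
    · exact hQS u hu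
    · exact hRsupp i u hu
  · intro u hu
    have keep (y : ι × Bool) (hy : (P y.1).ending y.2 = u) (hyu : ∀ huN : u ∈ N, x ⟨u, huN⟩ ≠ y) :
        (R y.1).ending y.2 = u := by
      rw [hRend y.1 y.2, hy]
      intro a hay
      have := hx a
      rw [hay, hy] at this
      subst this
      exact hyu a.2 hay
    by_cases huv : u = v
    · subst huv
      obtain ⟨y, z, hyz, hw⟩ := hQv
      have ok (w : Option ι × Bool) (hwyz : w = y ∨ w = z) :
          (w.1.elim Q R : GraphPath G).ending w.2 = u := by
        rcases hw w hwyz with ⟨h1, h2⟩ | ⟨a, rfl⟩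
        · rw [h1]
          exact h2
        · exact hRv _ a rfl
      exact ⟨y, z, hyz, ok y (.inl rfl), ok z (.inr rfl)⟩
    · obtain ⟨y, z, hyz, hy, hz⟩ := h.ends u ((mem_insert.1 hu).resolve_left huv)
      by_cases huN : u ∈ N
      -- A neighbour loses at most the selected end and gets an end of `Q` in exchange.
      · obtain ⟨c, hc⟩ := hQN u huN
        by_cases hxy : x ⟨u, huN⟩ = y
        · exact ⟨(none, c), (some z.1, z.2), by simp, hc, keep z hz fun _ => hxy ▸ hyz⟩
        · exact ⟨(none, c), (some y.1, y.2), by simp, hc, keep y hy fun _ => hxy⟩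
      · refine ⟨(some y.1, y.2), (some z.1, z.2), fun hyz' => hyz ?_,
          keep y hy fun h => absurd h huN, keep z hz fun h => absurd h huN⟩
        simp only [Prod.mk.injEq, Option.some.injEq] at hyz'
        exact Prod.ext hyz'.1 hyz'.2
  · intro e he heS
    rcases edge_cases e he heS with ⟨hve, heS⟩ | ⟨a, ha, rfl⟩
    · obtain ⟨i, j, hij, hi, hj⟩ := h.twice e he heS
      exact ⟨some i, some j, by simpa using hij, (hRold i e hve).2 hi, (hRold j e hve).2 hj⟩
    · exact ⟨none, some (x ⟨a, ha⟩).1, by simp, (hQ _).2 ⟨a, ha, rfl⟩, (hRnew _ ⟨a, ha⟩).2 rfl⟩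
  · intro e he f hf heS hfS hef
    rcases edge_cases e he heS with ⟨hve, heS⟩ | ⟨a, ha, rfl⟩ <;>
      rcases edge_cases f hf hfS with ⟨hvf, hfS⟩ | ⟨b, hb, rfl⟩
    · obtain ⟨i, hi, hi'⟩ := h.separates e he f hf heS hfS hef
      exact ⟨some i, (hRold i e hve).2 hi, fun h' => hi' ((hRold i f hvf).1 h')⟩
    -- Among the old paths only the one extended from `b` acquires the new edge, so one of the two
    -- paths through `e` avoids it.
    · obtain ⟨i, j, hij, hi, hj⟩ := h.twice e he heS
      by_cases hbi : (x ⟨b, hb⟩).1 = i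
      · exact ⟨some j, (hRold j e hve).2 hj,
          fun h' => hij (hbi.symm.trans ((hRnew j ⟨b, hb⟩).1 h'))⟩
      · exact ⟨some i, (hRold i e hve).2 hi, fun h' => hbi ((hRnew i ⟨b, hb⟩).1 h')⟩
    · exact ⟨none, (hQ _).2 ⟨a, ha, rfl⟩, hQold f hvf⟩
    · refine ⟨some (x ⟨a, ha⟩).1, (hRnew _ ⟨a, ha⟩).2 rfl, fun h' => hef ?_⟩
      rw [Subtype.mk.inj (hinj ⟨b, hb⟩ ⟨a, ha⟩ ((hRnew _ ⟨b, hb⟩).1 h'))]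

/-- In a graph in which every set of vertices has a vertex with at most two neighbours in the set,
there is a family of paths as above, with as many paths as vertices. -/
lemma exists_isPathFamily (hG : ∀ T : Finset V, T.Nonempty → ∃ v ∈ T, ∃ a b, ∀ u ∈ T, G.Adj v u →
    u = a ∨ u = b) (S : Finset V) :
    ∃ (ι : Type) (_ : Fintype ι) (P : ι → GraphPath G), Fintype.card ι = #S ∧
      IsPathFamily G S P := by
  classical
  induction hn : #S generalizing S with
  | zero =>
    rw [card_eq_zero] at hn
    subst hn
    refine ⟨Empty, inferInstance, Empty.elim, rfl, fun i => i.elim, by simp, ?_, ?_⟩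
    · intro e _ h
      exact absurd (h _ e.out_fst_mem) (notMem_empty _)
    · intro e _ _ _ h
      exact absurd (h _ e.out_fst_mem) (notMem_empty _)
  | succ n ih =>
    obtain ⟨v, hvS, a, b, hab⟩ := hG S (card_pos.1 (by lia))
    obtain ⟨T, hvT, rfl⟩ : ∃ T, v ∉ T ∧ insert v T = S :=
      ⟨S.erase v, notMem_erase v S, insert_erase hvS⟩
    obtain ⟨ι, _, P, hcard, hP⟩ := ih T (by rw [card_insert_of_notMem hvT] at hn; lia)
    suffices ∃ P' : Option ι → GraphPath G, IsPathFamily G (insert v T) P' by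
      obtain ⟨P', hP'⟩ := this
      exact ⟨Option ι, inferInstance, P', by simp [hcard], hP'⟩
    let N := T.filter (G.Adj v)
    have hNT : N ⊆ T := filter_subset _ _
    have hN : ∀ u ∈ T, G.Adj v u ↔ u ∈ N := by simp +contextual [N]
    have hN2 : #N ≤ 2 := by
      refine (card_le_card (t := {a, b}) fun u hu => ?_).trans card_le_two
      obtain ⟨hu1, hu2⟩ := mem_filter.1 hu
      simpa using hab u (mem_insert_of_mem hu1) hu2
    have hadj {u : V} (hu : u ∈ N) : G.Adj v u := (mem_filter.1 hu).2
    clear_value N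
    interval_cases hc : #N
    · rw [card_eq_zero] at hc
      subst hc
      have hend (c : Bool) : GraphPath.ending (G := G) ⟨v, v, .nil⟩ c = v := by cases c <;> rfl
      exact hP.insert_vertex hvT hNT hN (fun u => absurd u.2 (notMem_empty _))
        (fun u => absurd u.2 (notMem_empty _)) (fun u => absurd u.2 (notMem_empty _))
        ⟨v, v, .nil⟩ (by simp [GraphPath.Contains]) (by simp [GraphPath.support]) (by simp)
        ⟨(none, true), (none, false), by simp, by simp [hend]⟩
    · obtain ⟨c, rfl⟩ := card_eq_one.1 hc
      have hcT : c ∈ T := hNT (mem_singleton_self c)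
      have hcv : G.Adj c v := (hadj (mem_singleton_self c)).symm
      obtain ⟨x, -, -, hx, -⟩ := hP.ends c hcT
      refine hP.insert_vertex hvT hNT hN (fun _ => x) (fun u => ?_) (fun u w _ => ?_)
        ⟨c, v, hcv.toWalk, hcv.isPath_toWalk⟩ (by simp [GraphPath.Contains])
        (by simp [GraphPath.support, hcT]) (fun u hu => ⟨false, (mem_singleton.1 hu).symm⟩)
        ⟨(none, true), (some x.1, x.2), by simp, ?_⟩
      · rw [hx, mem_singleton.1 u.2]
      · exact Subsingleton.elim u w
      · rintro w (rfl | rfl)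
        · exact .inl ⟨rfl, rfl⟩
        · exact .inr ⟨⟨c, mem_singleton_self c⟩, rfl⟩
    · obtain ⟨c, d, hcd, rfl⟩ := card_eq_two.1 hc
      have hcN : c ∈ ({c, d} : Finset V) := by simp
      have hdN : d ∈ ({c, d} : Finset V) := by simp
      have hcv : G.Adj c v := (hadj hcN).symm
      have hvd : G.Adj v d := hadj hdN
      have hQ : (SimpleGraph.Walk.cons hcv hvd.toWalk).IsPath := by
        simp [SimpleGraph.Walk.isPath_def, hcd, hcv.ne, hvd.ne]
      obtain ⟨x, y, hx, hy, hxy⟩ : ∃ x y : ι × Bool, (P x.1).ending x.2 = c ∧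
          (P y.1).ending y.2 = d ∧ x.1 ≠ y.1 := by
        obtain ⟨x, x', hxx, hx, hx'⟩ := hP.ends c (hNT hcN)
        obtain ⟨y, y', hyy, hy, hy'⟩ := hP.ends d (hNT hdN)
        -- Otherwise all the ends at `c` and `d` would belong to one path: two ends at each of two
        -- distinct vertices, but a path has only two ends.
        by_contra! H
        have h1 := H x y hx hy
        have h2 := H x' y hx' hy
        have h3 := H x y' hx hy'
        obtain ⟨i, b⟩ := x
        obtain ⟨i', b'⟩ := x'
        obtain ⟨j, b₂⟩ := y
        obtain ⟨j', b₂'⟩ := y'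
        simp only at h1 h2 h3
        subst h1 h2 h3
        have h4 : b ≠ b' := fun h => hxx (by rw [h])
        have h5 : b₂ ≠ b₂' := fun h => hyy (by rw [h])
        have h6 : b ≠ b₂ := by rintro rfl; exact hcd (hx.symm.trans hy)
        have h7 : b ≠ b₂' := by rintro rfl; exact hcd (hx.symm.trans hy')
        clear * - h4 h5 h6 h7
        revert b b' b₂ b₂'
        decide
      refine hP.insert_vertex hvT hNT hN (fun u => if (u : V) = c then x else y) (fun u => ?_)
        (fun u w huw => ?_) ⟨c, d, _, hQ⟩ (by simp [GraphPath.Contains, Sym2.eq_swap])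
        (by simp [GraphPath.support, hNT hcN, hNT hdN]) (fun u hu => ?_)
        ⟨(some x.1, x.2), (some y.1, y.2), by simp [hxy], ?_⟩
      · obtain ⟨u, hu⟩ := u
        rcases mem_insert.1 hu with rfl | hu'
        · simp [hx]
        · rw [mem_singleton] at hu'
          subst hu'
          simp [hcd.symm, hy]
      · have other (u : ({c, d} : Finset V)) (hu : (u : V) ≠ c) : (u : V) = d :=
          mem_singleton.1 ((mem_insert.1 u.2).resolve_left hu)
        split_ifs at huw with h1 h2 h2
        · exact Subtype.ext (h1.trans h2.symm)
        · exact absurd huw hxy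
        · exact absurd huw.symm hxy
        · exact Subtype.ext ((other u h1).trans (other w h2).symm)
      · rcases mem_insert.1 hu with rfl | hu'
        · exact ⟨false, rfl⟩
        · exact ⟨true, (mem_singleton.1 hu').symm⟩
      · rintro w (rfl | rfl)
        · exact .inr ⟨⟨c, hcN⟩, by simp⟩
        · exact .inr ⟨⟨d, hdN⟩, by simp [hcd.symm]⟩

/-- A graph in which every set of vertices has a vertex with at most two neighbours in the set has
a strongly separating path system with at most as many paths as vertices. -/
theorem ssp_le_card_of_two_degenerate [Fintype V] (hG : ∀ T : Finset V, T.Nonempty →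
    ∃ v ∈ T, ∃ a b, ∀ u ∈ T, G.Adj v u → u = a ∨ u = b) : ssp G ≤ (Fintype.card V : ℕ∞) := by
  obtain ⟨ι, _, P, hcard, hP⟩ := exists_isPathFamily hG univ
  have hsep : IsStronglySeparatingPathSystem G (Set.range P) := by
    intro e he f hf hef
    obtain ⟨i, hi⟩ := hP.separates e he f hf (by simp) (by simp) hef
    obtain ⟨j, hj⟩ := hP.separates f hf e he (by simp) (by simp) hef.symm
    exact ⟨⟨P i, ⟨i, rfl⟩, hi⟩, ⟨P j, ⟨j, rfl⟩, hj⟩⟩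
  refine (iInf₂_le _ hsep).trans ?_
  rw [← Set.image_univ]
  refine (Set.encard_image_le _ _).trans ?_
  rw [Set.encard_univ, ENat.card_eq_coe_fintype_card, hcard, card_univ]

end

/-! ### Walks in a plane drawing -/

namespace PlaneDrawing

variable {V : Type*} {G : SimpleGraph V} (D : PlaneDrawing G)

/-- The part of a drawing that represents a walk. -/
def walkSet : ∀ {u v : V}, G.Walk u v → Set Plane
  | u, _, .nil => {D.point u}
  | u, _, .cons (v := v) h w => D.arc ⟨s(u, v), h⟩ ∪ walkSet w

lemma isCompact_arc (e : G.edgeSet) : IsCompact (D.arc e) := by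
  obtain ⟨e, he⟩ := e
  induction e with
  | _ u v =>
    obtain ⟨γ, -, hγ⟩ := D.isArcBetween u v he
    rw [← hγ]
    exact isCompact_range γ.continuous

lemma isPreconnected_arc (e : G.edgeSet) : IsPreconnected (D.arc e) := by
  obtain ⟨e, he⟩ := e
  induction e with
  | _ u v =>
    obtain ⟨γ, -, hγ⟩ := D.isArcBetween u v he
    rw [← hγ]
    exact isPreconnected_range γ.continuous

lemma point_mem_arc_of_mem {e : G.edgeSet} {v : V} (hv : v ∈ (e : Sym2 V)) :
    D.point v ∈ D.arc e := by
  obtain ⟨e, he⟩ := e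
  obtain ⟨u, rfl⟩ := hv
  obtain ⟨γ, -, hγ⟩ := D.isArcBetween v u he
  rw [← hγ]
  exact ⟨0, γ.source⟩

lemma point_left_mem_walkSet {u v : V} (w : G.Walk u v) : D.point u ∈ D.walkSet w := by
  cases w with
  | nil => exact rfl
  | cons h w => exact .inl (D.point_mem_arc_of_mem (Sym2.mem_mk_left _ _))

lemma point_right_mem_walkSet {u v : V} (w : G.Walk u v) : D.point v ∈ D.walkSet w := by
  induction w with
  | nil => exact rfl
  | cons h w ih => exact .inr ih

lemma isCompact_walkSet {u v : V} (w : G.Walk u v) : IsCompact (D.walkSet w) := by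
  induction w with
  | nil => exact isCompact_singleton
  | cons h w ih => exact (D.isCompact_arc _).union ih

lemma isPreconnected_walkSet {u v : V} (w : G.Walk u v) : IsPreconnected (D.walkSet w) := by
  induction w with
  | nil => exact isPreconnected_singleton
  | cons h w ih =>
    exact (D.isPreconnected_arc _).union _ (D.point_mem_arc_of_mem (Sym2.mem_mk_right _ _))
      (D.point_left_mem_walkSet w) ih

lemma mem_walkSet {u v : V} {w : G.Walk u v} {z : Plane} (hz : z ∈ D.walkSet w) :
    (∃ x ∈ w.support, D.point x = z) ∨
      ∃ e : G.edgeSet, (∀ x ∈ (e : Sym2 V), x ∈ w.support) ∧ z ∈ D.arc e := by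
  induction w with
  | nil => exact .inl ⟨_, by simp, hz.symm⟩
  | @cons a b c h w ih =>
    rcases hz with hz | hz
    · refine .inr ⟨_, fun x hx => ?_, hz⟩
      rcases Sym2.mem_iff.1 hx with rfl | rfl <;> simp
    · rcases ih hz with ⟨x, hx, hxz⟩ | ⟨e, he, hez⟩
      · exact .inl ⟨x, by simp [hx], hxz⟩
      · exact .inr ⟨e, fun x hx => by simp [he x hx], hez⟩

lemma walkSet_subset_carrier {u v : V} (w : G.Walk u v) : D.walkSet w ⊆ D.carrier := by
  intro z hz
  rcases D.mem_walkSet hz with ⟨x, -, hx⟩ | ⟨e, -, he⟩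
  · exact .inl ⟨x, hx⟩
  · exact .inr (Set.mem_iUnion.2 ⟨e, he⟩)

lemma mem_support_of_point_mem_walkSet {u v x : V} {w : G.Walk u v}
    (h : D.point x ∈ D.walkSet w) : x ∈ w.support := by
  rcases D.mem_walkSet h with ⟨y, hy, hyx⟩ | ⟨e, he, hex⟩
  · rwa [← D.point_injective hyx]
  · exact he x (D.point_mem_arc x e hex)

/-- Walks without a common vertex are drawn disjointly. -/
lemma disjoint_walkSet {a b c d : V} {w : G.Walk a b} {w' : G.Walk c d}
    (h : w.support.Disjoint w'.support) : Disjoint (D.walkSet w) (D.walkSet w') := by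
  rw [Set.disjoint_left]
  intro z hz hz'
  rcases D.mem_walkSet hz with ⟨x, hx, rfl⟩ | ⟨e, he, hez⟩
  · exact h hx (D.mem_support_of_point_mem_walkSet hz')
  · rcases D.mem_walkSet hz' with ⟨y, hy, rfl⟩ | ⟨f, hf, hfz⟩
    · exact h (he y (D.point_mem_arc y e hez)) hy
    · have hef : e ≠ f := by
        rintro rfl
        exact h (he _ (Sym2.out_fst_mem _)) (hf _ (Sym2.out_fst_mem _))
      obtain ⟨x, ⟨hxe, hxf⟩, -⟩ := D.arc_inter_arc e f hef ⟨hez, hfz⟩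
      exact h (he x hxe) (hf x hxf)

lemma isCompact_carrier [Finite V] : IsCompact D.carrier :=
  (Set.finite_range _).isCompact.union (isCompact_iUnion fun e => D.isCompact_arc e)

end PlaneDrawing

/-! ### Access to the vertices from the outer face -/

/-- The complement of a closed disc is connected. -/
lemma isPreconnected_setOf_lt_norm {R : ℝ} (hR : 0 ≤ R) : IsPreconnected {x : Plane | R < ‖x‖} := by
  have himage : (fun x : ℝ × Plane => x.1 • x.2) '' (Set.Ioi R ×ˢ Metric.sphere (0 : Plane) 1) =
      {x : Plane | R < ‖x‖} := by
    ext x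
    constructor
    · rintro ⟨⟨t, u⟩, ⟨ht, hu⟩, rfl⟩
      have ht : R < t := ht
      have hu : ‖u‖ = 1 := by simpa using hu
      change R < ‖t • u‖
      rw [norm_smul, hu, mul_one, Real.norm_eq_abs]
      exact ht.trans_le (le_abs_self t)
    · intro hx
      have hx : R < ‖x‖ := hx
      have hx0 : ‖x‖ ≠ 0 := (hR.trans_lt hx).ne'
      refine ⟨(‖x‖, ‖x‖⁻¹ • x), ⟨hx, ?_⟩, ?_⟩
      · simp [norm_smul, hx0]
      · simp [smul_smul, hx0]
  rw [← himage]
  refine (isPreconnected_Ioi.prod (isPreconnected_sphere ?_ 0 1)).image _ (by fun_prop)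
  rw [← Module.finrank_eq_rank, finrank_euclideanSpace_fin]
  norm_num

namespace PlaneDrawing

variable {V : Type*} {G : SimpleGraph V} (D : PlaneDrawing G)

/-- There is a point outside the drawing that can be joined, within its complement, to every point
of the outer face. -/
lemma exists_joinedIn_outerFace [Finite V] :
    ∃ p : Plane, ∀ z ∈ D.outerFace, JoinedIn D.carrierᶜ p z := by
  obtain ⟨R, hR0, hR⟩ := D.isCompact_carrier.isBounded.subset_closedBall_lt 0 0
  have hsub : {x : Plane | R < ‖x‖} ⊆ D.carrierᶜ := by
    intro x hx hxD
    have h1 : R < ‖x‖ := hx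
    have h2 : ‖x‖ ≤ R := by simpa using hR hxD
    linarith
  obtain ⟨p, hp⟩ := NormedSpace.exists_lt_norm ℝ Plane R
  refine ⟨p, fun z ⟨hz, hunb⟩ => ?_⟩
  -- An unbounded component reaches outside the disc of radius `R`, whose exterior is connected and
  -- misses the drawing; so it contains `p`.
  obtain ⟨y, hy, hyR⟩ : ∃ y ∈ connectedComponentIn D.carrierᶜ z, R < ‖y‖ := by
    by_contra! H
    exact hunb ((Metric.isBounded_closedBall (x := (0 : Plane)) (r := R)).subset fun y hy =>
      mem_closedBall_zero_iff.2 (H y hy))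
  have hpz : p ∈ connectedComponentIn D.carrierᶜ z := by
    rw [connectedComponentIn_eq hy]
    exact (isPreconnected_setOf_lt_norm hR0.le).subset_connectedComponentIn hyR hsub hp
  have hopen : IsOpen (connectedComponentIn D.carrierᶜ z) :=
    D.isCompact_carrier.isClosed.isOpen_compl.connectedComponentIn
  have hconn : IsConnected (connectedComponentIn D.carrierᶜ z) :=
    isConnected_connectedComponentIn_iff.2 hz
  exact ((hopen.isConnected_iff_isPathConnected.1 hconn).joinedIn p hpz z
    (mem_connectedComponentIn hz)).mono (connectedComponentIn_subset _ _)

/-- A vertex on the boundary of the outer face can be joined to a point of the outer face away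
from the parts of the drawing that do not contain the vertex. -/
lemma exists_joining_set {p : Plane} (hp : ∀ z ∈ D.outerFace, JoinedIn D.carrierᶜ p z) {v : V}
    (hv : D.point v ∈ frontier D.outerFace) {K : Set Plane} (hK : IsCompact K)
    (hKD : K ⊆ D.carrier) (hvK : D.point v ∉ K) :
    ∃ B : Set Plane, IsCompact B ∧ IsPreconnected B ∧ D.point v ∈ B ∧ p ∈ B ∧ Disjoint B K := by
  obtain ⟨ε, hε, hball⟩ := Metric.isOpen_iff.1 hK.isClosed.isOpen_compl (D.point v) hvK
  -- The point `z` is close enough for the segment to the vertex to miss `K`. The segment may meet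
  -- the rest of the drawing, which is harmless.
  obtain ⟨z, hz, hzv⟩ := Metric.mem_closure_iff.1 (frontier_subset_closure hv) ε hε
  obtain ⟨γ, hγ⟩ := hp z hz
  have hseg : IsPreconnected (segment ℝ z (D.point v)) := (convex_segment _ _).isPreconnected
  refine ⟨Set.range γ ∪ segment ℝ z (D.point v), (isCompact_range γ.continuous).union ?_,
    (isPreconnected_range γ.continuous).union z ⟨1, γ.target⟩ (left_mem_segment ℝ _ _) hseg,
    .inr (right_mem_segment ℝ _ _), .inl ⟨0, γ.source⟩, ?_⟩
  · rw [segment_eq_image_lineMap]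
    exact isCompact_Icc.image (AffineMap.lineMap_continuous)
  · rw [Set.disjoint_left]
    rintro x (⟨t, rfl⟩ | hx) hxK
    · exact hγ t (hKD hxK)
    · exact hball ((convex_ball (D.point v) ε).segment_subset (by rwa [Metric.mem_ball, dist_comm])
        (Metric.mem_ball_self hε) hx) hxK

end PlaneDrawing

/-! ### Contradiction with the complete graph on five vertices -/

/-- In a drawing with all vertices on the boundary of the outer face there are no four vertices that
are joined pairwise by walks such that walks without a common end are disjoint. -/
lemma IsOuterplanar.not_exists_walks {V : Type*} [Finite V] {G : SimpleGraph V}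
    (hG : IsOuterplanar G) {a b c d : V} (ab : G.Walk a b) (cd : G.Walk c d) (ac : G.Walk a c)
    (bd : G.Walk b d) (ad : G.Walk a d) (bc : G.Walk b c) (h1 : ab.support.Disjoint cd.support)
    (h2 : ac.support.Disjoint bd.support) (h3 : ad.support.Disjoint bc.support) : False := by
  obtain ⟨D, hD⟩ := hG
  obtain ⟨p, hp⟩ := D.exists_joinedIn_outerFace
  have esc (v : V) {x₁ y₁ x₂ y₂ x₃ y₃ : V} (w₁ : G.Walk x₁ y₁) (w₂ : G.Walk x₂ y₂)
      (w₃ : G.Walk x₃ y₃) (hw₁ : v ∉ w₁.support) (hw₂ : v ∉ w₂.support) (hw₃ : v ∉ w₃.support) :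
      ∃ B : Set Plane, IsCompact B ∧ IsPreconnected B ∧ D.point v ∈ B ∧ p ∈ B ∧
        Disjoint B (D.walkSet w₁) ∧ Disjoint B (D.walkSet w₂) ∧ Disjoint B (D.walkSet w₃) := by
    obtain ⟨B, hB1, hB2, hB3, hB4, hB5⟩ := D.exists_joining_set hp (hD v)
      (((D.isCompact_walkSet w₁).union (D.isCompact_walkSet w₂)).union (D.isCompact_walkSet w₃))
      (Set.union_subset (Set.union_subset (D.walkSet_subset_carrier w₁)
        (D.walkSet_subset_carrier w₂)) (D.walkSet_subset_carrier w₃)) (by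
        rintro ((h | h) | h)
        · exact hw₁ (D.mem_support_of_point_mem_walkSet h)
        · exact hw₂ (D.mem_support_of_point_mem_walkSet h)
        · exact hw₃ (D.mem_support_of_point_mem_walkSet h))
    simp only [Set.disjoint_union_right] at hB5
    exact ⟨B, hB1, hB2, hB3, hB4, hB5.1.1, hB5.1.2, hB5.2⟩
  obtain ⟨Ba, a1, a2, a3, a4, a5, a6, a7⟩ := esc a bc bd cd (h3 ad.start_mem_support)
    (h2 ac.start_mem_support) (h1 ab.start_mem_support)
  obtain ⟨Bb, b1, b2, b3, b4, b5, b6, b7⟩ := esc b ac ad cd (h2.symm bd.start_mem_support)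
    (h3.symm bc.start_mem_support) (h1 ab.end_mem_support)
  obtain ⟨Bc, c1, c2, c3, c4, c5, c6, c7⟩ := esc c ab ad bd (h1.symm cd.start_mem_support)
    (h3.symm bc.end_mem_support) (h2 ac.end_mem_support)
  obtain ⟨Bd, d1, d2, d3, d4, d5, d6, d7⟩ := esc d ab ac bc (h1.symm cd.end_mem_support)
    (h2.symm bd.end_mem_support) (h3 ad.end_mem_support)
  let P : Fin 5 → Plane := ![D.point a, D.point b, D.point c, D.point d, p]
  -- Only entries above the diagonal matter. The sets in the last column all contain `p` and may
  -- overlap, since these edges share an end.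
  let A : Fin 5 → Fin 5 → Set Plane := ![![∅, D.walkSet ab, D.walkSet ac, D.walkSet ad, Ba],
    ![∅, ∅, D.walkSet bc, D.walkSet bd, Bb], ![∅, ∅, ∅, D.walkSet cd, Bc], ![∅, ∅, ∅, ∅, Bd],
    ![∅, ∅, ∅, ∅, ∅]]
  have pairs (Q : Fin 5 → Fin 5 → Prop) (q01 : Q 0 1) (q02 : Q 0 2) (q03 : Q 0 3) (q04 : Q 0 4)
      (q12 : Q 1 2) (q13 : Q 1 3) (q14 : Q 1 4) (q23 : Q 2 3) (q24 : Q 2 4) (q34 : Q 3 4) :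
      ∀ i j, i < j → Q i j := by
    intro i j hij
    fin_cases i <;> fin_cases j <;> first | assumption | exact absurd hij (by decide)
  let L : List ((Fin 5 × Fin 5) × (Fin 5 × Fin 5)) :=
    [((0, 1), (2, 3)), ((0, 2), (1, 3)), ((0, 3), (1, 2)),
      ((0, 4), (1, 2)), ((0, 4), (1, 3)), ((0, 4), (2, 3)),
      ((1, 4), (0, 2)), ((1, 4), (0, 3)), ((1, 4), (2, 3)),
      ((2, 4), (0, 1)), ((2, 4), (0, 3)), ((2, 4), (1, 3)),
      ((3, 4), (0, 1)), ((3, 4), (0, 2)), ((3, 4), (1, 2))]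
  have hL : ∀ i j k l : Fin 5, i < j → k < l → [i, j, k, l].Nodup →
      ((i, j), (k, l)) ∈ L ∨ ((k, l), (i, j)) ∈ L := by decide +kernel
  have hdisj : ∀ x ∈ L, Disjoint (A x.1.1 x.1.2) (A x.2.1 x.2.2) := by
    simp only [L, List.forall_mem_cons]
    exact ⟨D.disjoint_walkSet h1, D.disjoint_walkSet h2, D.disjoint_walkSet h3, a5, a6, a7, b5, b6,
      b7, c5, c6, c7, d5, d6, d7, by simp⟩
  obtain ⟨i, j, k, l, hij, hkl, hnd, hne⟩ := exists_inter_nonempty_of_five P A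
    (pairs _ (D.isCompact_walkSet ab) (D.isCompact_walkSet ac) (D.isCompact_walkSet ad) a1
      (D.isCompact_walkSet bc) (D.isCompact_walkSet bd) b1 (D.isCompact_walkSet cd) c1 d1)
    (pairs _ (D.isPreconnected_walkSet ab) (D.isPreconnected_walkSet ac)
      (D.isPreconnected_walkSet ad) a2 (D.isPreconnected_walkSet bc) (D.isPreconnected_walkSet bd)
      b2 (D.isPreconnected_walkSet cd) c2 d2)
    (pairs _ (D.point_left_mem_walkSet ab) (D.point_left_mem_walkSet ac)
      (D.point_left_mem_walkSet ad) a3 (D.point_left_mem_walkSet bc) (D.point_left_mem_walkSet bd)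
      b3 (D.point_left_mem_walkSet cd) c3 d3)
    (pairs _ (D.point_right_mem_walkSet ab) (D.point_right_mem_walkSet ac)
      (D.point_right_mem_walkSet ad) a4 (D.point_right_mem_walkSet bc)
      (D.point_right_mem_walkSet bd) b4 (D.point_right_mem_walkSet cd) c4 d4)
  rw [← Set.not_disjoint_iff_nonempty_inter] at hne
  rcases hL i j k l hij hkl hnd with h | h
  · exact hne (hdisj _ h)
  · exact hne (hdisj _ h).symm

theorem mainTheorem8 {V : Type*} [Fintype V] (G : SimpleGraph V) (hG : IsOuterplanar G) :
    ssp G ≤ (Fintype.card V : ℕ∞) := by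
  refine ssp_le_card_of_two_degenerate fun T hT => ?_
  -- The negation says that no two vertices exhaust the neighbours in `T` of any vertex of `T`: each
  -- has at least three.
  by_contra! H
  obtain ⟨a, b, c, d, ab, cd, ac, bd, ad, bc, h1, h2, h3⟩ :=
    exists_walks_of_three_neighbors (G := G) (S := (T : Set V)) hT H
  exact hG.not_exists_walks ab cd ac bd ad bc h1 h2 h3
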